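/- For positive integers $\ell, t$ and $n \ge 0$, let $\mathrm{RD}^{(\ell,t)}(n)$ denote the number of partitions of $n$ in which no part is divisible by $\ell$ and every part occurs fewer than $t$ times. Then, for all $n \ge 0$, $$\mathrm{RD}^{(4,9)}(24n+23) \equiv 0 \pmod{24},$$ $$\mathrm{RD}^{(4,9)}(48n+29) \equiv 0 \pmod{24},$$ $$\mathrm{RD}^{(4,9)}(96n+89) \equiv 0 \pmod{24}.$$ -/

import Mathlib

/-- The set of partitions of `n` that are simultaneously `ℓ`-regular (no part is divisible by `ℓ`)
and `t`-distinct (every part occurs fewer than `t` times). -/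
def regularDistinct (ℓ t n : ℕ) : Finset n.Partition :=
  {p : n.Partition | (∀ i ∈ p.parts, ¬ ℓ ∣ i) ∧ ∀ i ∈ p.parts, p.parts.count i < t}

/-- The number `RD^{(ℓ,t)}(n)` of partitions of `n` that are simultaneously `ℓ`-regular and
`t`-distinct. -/
def RD (ℓ t n : ℕ) : ℕ := (regularDistinct ℓ t n).card

/-!
Write `E k` for Euler's product `∏ (1 - X ^ (k n))`, so that `∑ RD^{(4,9)}(n) X ^ n` is
`E 4 * E 9 / (E 1 * E 36)`. The 3-dissections of Ramanujan's functions `φ` and `ψ` show that its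
odd part `f = ∑ RD^{(4,9)}(2 n + 1) X ^ n` equals `E 2 ^ 3 * E 3 / (E 1 ^ 3 * E 6)`. Classical
identities for `φ` and `ψ` then give `f(X) f(-X) = f(X ^ 2)` and `f(X) + f(-X) = 2 f(X ^ 2) ^ 2`.
Hence the 2-dissection of `f` is `f(X ^ 2) ^ 2 + X o(X ^ 2)`, where `f ^ 4 - X o ^ 2 = f`, and
comparison with `f ^ 4 - f = 9 X E 2 ^ 4 * E 6 ^ 4 / E 1 ^ 8` yields
`o = 3 E 2 ^ 2 * E 6 ^ 2 / E 1 ^ 4`.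

Modulo 3 the formula for `f` collapses to `f ≡ 1`. Modulo 8, iterating the 2-dissection reduces
the three progressions to `o ≡ 3 φ ^ 2 * E 6 ^ 2` (mod 8), `o ≡ 3 E 6 ^ 2` (mod 4) and
`f ≡ ψ * E 3 / E 6` (mod 2), together with the absence of exponents congruent to 2 modulo 3
in `ψ`.
-/

open PowerSeries PowerSeries.WithPiTopology Filter
open Finset.HasAntidiagonal (antidiagonal mem_antidiagonal)

section CyclicNorm
variable {R : Type*} [CommRing R]

theorem rescale_C_mul_X_pow (z c : R) (n : ℕ) :
    rescale z (C c * X ^ n : R⟦X⟧) = C (c * z ^ n) * X ^ n := by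
  ext i
  rw [coeff_rescale, coeff_C_mul_X_pow, coeff_C_mul_X_pow]
  split_ifs with h
  · rw [h, mul_comm]
  · rw [mul_zero]

theorem rescale_expand {m : ℕ} (hm : m ≠ 0) {z : R} (hz : z ^ m = 1) (f : R⟦X⟧) :
    rescale z (expand m hm f) = expand m hm f := by
  ext n
  rw [coeff_rescale, coeff_expand]
  split_ifs with h
  · obtain ⟨j, rfl⟩ := h
    rw [pow_mul, hz, one_pow, one_mul]
  · rw [mul_zero]

theorem expand_injective {m : ℕ} (hm : m ≠ 0) :
    Function.Injective (expand m hm : R⟦X⟧ → R⟦X⟧) := fun f g h ↦ by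
  ext n
  rw [← coeff_expand_mul m hm f, h, coeff_expand_mul]

theorem prod_sub_primitiveRoot_pow_mul {A : Type*} [CommRing A] [IsDomain A] {m : ℕ} [NeZero m]
    {ζ : A} (hζ : IsPrimitiveRoot ζ m) (x y : A) :
    ∏ i ∈ Finset.range m, (x - ζ ^ i * y) = x ^ m - y ^ m := by
  classical
  rw [hζ.pow_sub_pow_eq_prod_sub_mul x y (NeZero.pos m), Finset.prod, Finset.prod,
    Polynomial.nthRootsFinset_def, Multiset.toFinset_val, hζ.nthRoots_one_nodup.dedup,
    hζ.nthRoots_eq (one_pow m), Multiset.map_map, Finset.range_val]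
  simp only [Function.comp_def, mul_one]

/-- The product of the twists `f (ζ ^ i X)`, for `i < m`. When `ζ` is a primitive `m`-th root of
unity this is the norm of `f` over the series in `X ^ m`. -/
noncomputable def cyclicNorm (ζ : R) (m : ℕ) : R⟦X⟧ →* R⟦X⟧ :=
  ∏ i ∈ Finset.range m, (rescale (ζ ^ i) : R⟦X⟧ →* R⟦X⟧)

theorem cyclicNorm_apply (ζ : R) (m : ℕ) (f : R⟦X⟧) :
    cyclicNorm ζ m f = ∏ i ∈ Finset.range m, rescale (ζ ^ i) f := by
  rw [cyclicNorm, MonoidHom.finsetProd_apply]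
  rfl

theorem cyclicNorm_expand_sub [IsDomain R] {m : ℕ} (hm : m ≠ 0) {ζ : R} (hζ : IsPrimitiveRoot ζ m)
    (f g : R⟦X⟧) :
    cyclicNorm ζ m (expand m hm f - X * expand m hm g) = expand m hm (f ^ m - X * g ^ m) := by
  have : NeZero m := ⟨hm⟩
  have htwist (i : ℕ) : rescale (ζ ^ i) (expand m hm f - X * expand m hm g) =
      expand m hm f - C ζ ^ i * (X * expand m hm g) := by
    have hζi : (ζ ^ i) ^ m = 1 := by rw [pow_right_comm, hζ.pow_eq_one, one_pow]
    rw [map_sub, map_mul, rescale_X, rescale_expand hm hζi, rescale_expand hm hζi, map_pow,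
      mul_assoc]
  simp only [cyclicNorm_apply, htwist]
  rw [prod_sub_primitiveRoot_pow_mul (hζ.map_of_injective C_injective)]
  simp only [map_sub, map_mul, map_pow, expand_X, mul_pow]

end CyclicNorm

section InfiniteProducts
variable {R : Type*} [CommRing R] [TopologicalSpace R]

/-- The infinite product `∏ (1 + c X ^ (a n + b))` over `n ≥ 0`. -/
noncomputable def qProd (c : R) (a b : ℕ) : R⟦X⟧ := ∏' n : ℕ, (1 + C c * X ^ (a * n + b))

theorem continuous_powerSeries_of_coeff {T : Type*} [TopologicalSpace T] {F : T → R⟦X⟧}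
    (h : ∀ d, Continuous fun f ↦ coeff d (F f)) : Continuous F :=
  continuous_iff_continuousAt.mpr fun f ↦
    (tendsto_iff_coeff_tendsto _ _ _ _).mpr fun d ↦ (h d).tendsto f

theorem continuous_expand {m : ℕ} (hm : m ≠ 0) : Continuous (expand m hm : R⟦X⟧ → R⟦X⟧) :=
  continuous_powerSeries_of_coeff fun d ↦ by
    simp only [coeff_expand]
    split_ifs
    exacts [continuous_coeff R _, continuous_const]

theorem continuous_rescale [IsTopologicalRing R] (z : R) : Continuous (rescale z : R⟦X⟧ → R⟦X⟧) :=
  continuous_powerSeries_of_coeff fun d ↦ by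
    simpa only [coeff_rescale] using (continuous_coeff R d).const_mul _

theorem multipliable_qProd (c : R) (a : ℕ) [NeZero a] (b : ℕ) :
    Multipliable fun n : ℕ ↦ (1 + C c * X ^ (a * n + b) : R⟦X⟧) := by
  apply multipliable_one_add_of_tendsto_order_atTop_nhds_top
  refine ENat.tendsto_nhds_top_iff_natCast_lt.mpr fun n ↦
    eventually_atTop.mpr ⟨n + 1, fun m hm ↦ ?_⟩
  have hlt : n < a * m + b := by nlinarith [NeZero.pos a]
  calc (n : ℕ∞) < (a * m + b : ℕ) := by exact_mod_cast hlt
    _ ≤ (C c * X ^ (a * m + b) : R⟦X⟧).order := by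
      refine nat_le_order _ _ fun i hi ↦ ?_
      rw [coeff_C_mul_X_pow, if_neg hi.ne]

theorem hasProd_qProd (c : R) (a : ℕ) [NeZero a] (b : ℕ) :
    HasProd (fun n : ℕ ↦ (1 + C c * X ^ (a * n + b) : R⟦X⟧)) (qProd c a b) :=
  (multipliable_qProd c a b).hasProd

theorem map_qProd {S : Type*} [CommRing S] [TopologicalSpace S] [T2Space S]
    {f : R →+* S} (hf : Continuous f) (c : R) (a : ℕ) [NeZero a] (b : ℕ) :
    map f (qProd c a b) = qProd (f c) a b := by
  have hcont : Continuous (map f : R⟦X⟧ → S⟦X⟧) :=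
    continuous_powerSeries_of_coeff fun d ↦ by
      simp only [coeff_map]
      exact hf.comp (continuous_coeff R d)
  rw [qProd, (multipliable_qProd c a b).map_tprod _ hcont, qProd]
  simp only [map_add, map_one, map_mul, map_pow, map_C, map_X]

variable [T2Space R]

theorem expand_qProd (m : ℕ) [NeZero m] (c : R) (a : ℕ) [NeZero a] (b : ℕ) :
    expand m (NeZero.ne m) (qProd c a b) = qProd c (m * a) (m * b) := by
  rw [qProd, (multipliable_qProd c a b).map_tprod _ (continuous_expand _), qProd]
  simp only [map_add, map_one, map_mul, map_pow, expand_C, expand_X, ← pow_mul, mul_add, mul_assoc]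

theorem qProd_eq_prod_qProd (m : ℕ) [NeZero m] (c : R) (a : ℕ) [NeZero a] (b : ℕ)
    [IsTopologicalRing R] :
    qProd c a b = ∏ r : Fin m, qProd c (a * m) (a * r + b) := by
  have h := hasProd_qProd c a b
  rw [← ((Equiv.prodComm _ _).trans (Nat.divModEquiv m).symm).hasProd_iff] at h
  have hfiber := h.prod_fiberwise (g := fun r : Fin m ↦ qProd c (a * m) (a * r + b)) fun r ↦ by
    convert hasProd_qProd c (a * m) (a * r + b) using 1
    funext n
    simp only [Function.comp, Equiv.trans_apply, Equiv.prodComm_apply, Prod.swap_prod_mk,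
      Nat.divModEquiv_symm_apply, mul_add, add_assoc, mul_comm n m, mul_assoc]
  exact hfiber.unique (hasProd_fintype _)

theorem constantCoeff_qProd (c : R) (a b : ℕ) [NeZero a] [NeZero b] :
    constantCoeff (qProd c a b) = 1 := by
  rw [qProd, (multipliable_qProd c a b).map_tprod _ (continuous_constantCoeff R)]
  simp [NeZero.ne b]

theorem X_pow_dvd_qProd_sub_one {a b d : ℕ} (hd : d ≤ b) (c : R) [NeZero a] :
    X ^ d ∣ qProd c a b - 1 := by
  have hfinite (s : Finset ℕ) : X ^ d ∣ ∏ n ∈ s, (1 + C c * X ^ (a * n + b)) - 1 := by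
    refine Finset.prod_induction _ (X ^ d ∣ · - 1) (fun f g hf hg ↦ ?_) (by simp) fun n _ ↦ ?_
    · rw [show f * g - 1 = f * (g - 1) + (f - 1) by ring]
      exact dvd_add (hg.mul_left f) hf
    · rw [add_sub_cancel_left]
      exact (pow_dvd_pow X (by lia)).mul_left _
  simp only [X_pow_dvd_iff, map_sub, sub_eq_zero] at hfinite ⊢
  intro i hi
  refine tendsto_nhds_unique (((continuous_coeff R i).tendsto _).comp (hasProd_qProd c a b)) ?_
  exact tendsto_const_nhds.congr fun s ↦ (hfinite s i hi).symm

variable [IsTopologicalRing R]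

theorem rescale_qProd {z : R} {a : ℕ} (hz : z ^ a = 1) (c : R) [NeZero a] (b : ℕ) :
    rescale z (qProd c a b) = qProd (c * z ^ b) a b := by
  rw [qProd, (multipliable_qProd c a b).map_tprod _ (continuous_rescale z), qProd]
  refine tprod_congr fun n ↦ ?_
  rw [map_add, map_one, rescale_C_mul_X_pow, pow_add, pow_mul, hz, one_pow, one_mul]

theorem qProd_eq_prod_range_mul (c : R) (a : ℕ) [NeZero a] (b N : ℕ) :
    qProd c a b = (∏ n ∈ Finset.range N, (1 + C c * X ^ (a * n + b))) * qProd c a (a * N + b) := by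
  have h := multipliable_qProd c a (a * N + b)
  have hshift (n : ℕ) : a * n + (a * N + b) = a * (n + N) + b := by ring
  simp only [qProd, hshift] at h ⊢
  exact (Multipliable.prod_mul_tprod_nat_mul' (f := fun n ↦ 1 + C c * X ^ (a * n + b)) h).symm

theorem prod_qProd_primitiveRoot_pow [IsDomain R] {m : ℕ} [NeZero m] {ζ : R}
    (hζ : IsPrimitiveRoot ζ m) (a : ℕ) [NeZero a] (b : ℕ) :
    ∏ i ∈ Finset.range m, qProd (-ζ ^ i) a b = qProd (-1) (m * a) (m * b) := by
  simp only [qProd]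
  rw [← Multipliable.tprod_finsetProd fun i _ ↦ multipliable_qProd (-ζ ^ i) a b]
  refine tprod_congr fun n ↦ ?_
  have hfactor := prod_sub_primitiveRoot_pow_mul (hζ.map_of_injective C_injective) 1
    (X ^ (a * n + b))
  simpa [← pow_mul, sub_eq_add_neg, mul_comm m, mul_assoc, add_mul] using hfactor

theorem cyclicNorm_qProd_of_coprime [IsDomain R] {m b : ℕ} [NeZero m] {ζ : R}
    (hζ : IsPrimitiveRoot ζ m) (hb : b.Coprime m) (a : ℕ) [NeZero a] :
    cyclicNorm ζ m (qProd (-1) (m * a) b) = qProd (-1) (m * (m * a)) (m * b) := by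
  rw [cyclicNorm_apply, ← prod_qProd_primitiveRoot_pow (hζ.pow_of_coprime b hb)]
  refine Finset.prod_congr rfl fun i _ ↦ ?_
  rw [rescale_qProd (by rw [← pow_mul, mul_left_comm, pow_mul, hζ.pow_eq_one, one_pow]),
    neg_one_mul, pow_right_comm]

theorem cyclicNorm_qProd_of_dvd {m a b : ℕ} [NeZero m] [NeZero a] {ζ : R} (hζ : ζ ^ m = 1)
    (ha : m ∣ a) (hb : m ∣ b) :
    cyclicNorm ζ m (qProd (-1) a b) = qProd (-1) a b ^ m := by
  rw [cyclicNorm_apply, ← Finset.card_range m, ← Finset.prod_const]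
  refine Finset.prod_congr (by simp) fun i _ ↦ ?_
  have h (d) (hd : m ∣ d) : (ζ ^ i) ^ d = 1 := by
    obtain ⟨d, rfl⟩ := hd
    rw [← pow_mul, mul_left_comm, pow_mul, hζ, one_pow]
  rw [rescale_qProd (h a ha), h b hb, mul_one]

theorem qProd_self_eq_prod_mul (c : R) (m k : ℕ) [NeZero k] :
    qProd c k k = (∏ r ∈ Finset.range m, qProd c ((m + 1) * k) ((r + 1) * k)) *
      qProd c ((m + 1) * k) ((m + 1) * k) := by
  rw [qProd_eq_prod_qProd (m + 1),
    Fin.prod_univ_eq_prod_range (fun r ↦ qProd c (k * (m + 1)) (k * r + k)), Finset.prod_range_succ]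
  simp only [add_one_mul, mul_comm k]

theorem cyclicNorm_qProd_mul_qProd [IsDomain R] {p : ℕ} [NeZero p] (hp : p.Prime)
    {ζ : R} (hζ : IsPrimitiveRoot ζ p) {k : ℕ} [NeZero k] (hk : k.Coprime p) :
    cyclicNorm ζ p (qProd (-1) k k) * qProd (-1) (p * (p * k)) (p * (p * k)) =
      qProd (-1) (p * k) (p * k) ^ (p + 1) := by
  obtain ⟨m, rfl⟩ := Nat.exists_eq_add_one_of_ne_zero hp.ne_zero
  have hnorm (r) (hr : r ∈ Finset.range m) :
      cyclicNorm ζ (m + 1) (qProd (-1) ((m + 1) * k) ((r + 1) * k)) =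
        qProd (-1) ((m + 1) * ((m + 1) * k)) ((r + 1) * ((m + 1) * k)) := by
    have hcop : (r + 1).Coprime (m + 1) :=
      (Nat.coprime_of_lt_prime (by lia) (by simpa using hr) hp).symm
    rw [cyclicNorm_qProd_of_coprime hζ (hcop.mul_left hk), mul_left_comm (m + 1) (r + 1)]
  rw [qProd_self_eq_prod_mul _ m k, map_mul, map_prod, Finset.prod_congr rfl hnorm,
    cyclicNorm_qProd_of_dvd hζ.pow_eq_one (dvd_mul_right _ _) (dvd_mul_right _ _),
    pow_succ _ (m + 1), mul_right_comm, ← qProd_self_eq_prod_mul, mul_comm]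

end InfiniteProducts

section QBinomial
variable {A : Type*} [CommRing A]

/-- The triangular number `n (n + 1) / 2` of an integer. -/
def triangular (n : ℤ) : ℕ := (n * (n + 1) / 2).toNat

theorem two_mul_triangular (n : ℤ) : 2 * (triangular n : ℤ) = n * (n + 1) := by
  have hnonneg : 0 ≤ n * (n + 1) := by
    rcases le_or_gt 0 n with h | h
    · positivity
    · nlinarith
  rw [triangular, Int.toNat_of_nonneg (by positivity),
    Int.mul_ediv_cancel' (Int.even_mul_succ_self n).two_dvd]

theorem triangular_succ (n : ℕ) : triangular (n + 1 : ℕ) = triangular n + (n + 1) := by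
  have h₀ := two_mul_triangular n
  have h₁ := two_mul_triangular (n + 1 : ℕ)
  push_cast at h₁
  zify
  linarith

theorem prod_range_pow_succ (q : A) (n : ℕ) :
    ∏ i ∈ Finset.range n, q ^ (i + 1) = q ^ triangular n := by
  induction n with
  | zero => simp [triangular]
  | succ n ih => rw [Finset.prod_range_succ, ih, triangular_succ, ← pow_add]

/-- The Gaussian binomial coefficient `[m + k, k]` at `q`. -/
def gaussBinom (q : A) : ℕ → ℕ → A
  | 0, _ => 1
  | _ + 1, 0 => 1
  | m + 1, k + 1 => gaussBinom q m (k + 1) + q ^ (m + 1) * gaussBinom q (m + 1) k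

theorem gaussBinom_zero_right (q : A) (m : ℕ) : gaussBinom q m 0 = 1 := by
  cases m <;> simp [gaussBinom]

theorem gaussBinom_mul (q : A) (m k : ℕ) :
    gaussBinom q m k * (∏ i ∈ Finset.range m, (1 - q ^ (i + 1))) *
      (∏ i ∈ Finset.range k, (1 - q ^ (i + 1))) =
        ∏ i ∈ Finset.range (m + k), (1 - q ^ (i + 1)) := by
  induction m generalizing k with
  | zero => simp [gaussBinom]
  | succ m ihm =>
    induction k with
    | zero => simp [gaussBinom]
    | succ k ihk =>
      have hm := ihm (k + 1)
      rw [show m + (k + 1) = m + 1 + k by ring] at hm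
      rw [gaussBinom, ← add_assoc, Finset.prod_range_succ _ (m + 1 + k)]
      rw [Finset.prod_range_succ _ m] at ihk ⊢
      rw [Finset.prod_range_succ _ k] at hm ⊢
      linear_combination (1 - q ^ (m + 1)) * hm + q ^ (m + 1) * (1 - q ^ (k + 1)) * ihk

theorem q_binomial_theorem (q u v : A) (n : ℕ) :
    ∏ i ∈ Finset.range n, (u + v * q ^ (i + 1)) = ∑ p ∈ antidiagonal n,
      q ^ triangular p.2 * gaussBinom q p.1 p.2 * v ^ p.2 * u ^ p.1 := by
  set s : ℕ × ℕ → A := fun p ↦ q ^ triangular p.2 * gaussBinom q p.1 p.2 * v ^ p.2 * u ^ p.1 with hs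
  induction n with
  | zero => simp [hs, gaussBinom, triangular]
  | succ n ih =>
    let fromLeft : ℕ × ℕ → A := fun
      | (0, _) => 0
      | (m + 1, k) => s (m, k) * u
    let fromRight : ℕ × ℕ → A := fun
      | (_, 0) => 0
      | (m, k + 1) => s (m, k) * (v * q ^ (n + 1))
    have hpascal : ∀ p ∈ antidiagonal (n + 1), s p = fromLeft p + fromRight p := by
      rintro ⟨m, k⟩ hp
      rw [mem_antidiagonal] at hp
      match m, k with
      | 0, 0 => simp at hp
      | 0, k + 1 =>
        obtain rfl : k = n := by lia
        simp only [hs, fromLeft, fromRight, triangular_succ, gaussBinom]; ring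
      | m + 1, 0 => simp only [hs, fromLeft, fromRight, gaussBinom_zero_right]; ring
      | m + 1, k + 1 =>
        obtain rfl : n = m + k + 1 := by lia
        simp only [hs, fromLeft, fromRight, triangular_succ, gaussBinom]; ring
    rw [Finset.prod_range_succ, ih, Finset.sum_congr rfl hpascal, Finset.sum_add_distrib,
      Finset.Nat.sum_antidiagonal_succ, Finset.Nat.sum_antidiagonal_succ', mul_add, Finset.sum_mul,
      Finset.sum_mul]
    simp only [fromLeft, fromRight, zero_add, hs]

theorem triple_product_term (x y c : A) {N m k : ℕ} (hmk : m + k = 2 * N) :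
    (x * y) ^ triangular k * c * (x * (x * y) ^ N) ^ m =
      (x * y) ^ triangular N * (x * (x * y) ^ N) ^ N *
        (c * (x ^ triangular (m - N) * y ^ triangular (-(m - N)))) := by
  have hk : (k : ℤ) = 2 * N - m := by lia
  have hTk : 2 * (triangular k : ℤ) = (2 * N - m) * (2 * N - m + 1) := by
    rw [two_mul_triangular, hk]
  have hTN := two_mul_triangular N
  have hexpx : triangular k + N * m + m = triangular N + N * N + N + triangular (m - N) := by
    have := two_mul_triangular (m - N)
    zify
    linarith
  have hexpy : triangular k + N * m = triangular N + N * N + triangular (-(m - N)) := by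
    have := two_mul_triangular (-(m - N))
    zify
    linarith
  calc _ = c * x ^ (triangular k + N * m + m) * y ^ (triangular k + N * m) := by ring
    _ = _ := by rw [hexpx, hexpy]; ring

theorem finite_triple_product [IsDomain A] {x y : A} (hx : x ≠ 0) (hy : y ≠ 0) (N : ℕ) :
    (∏ n ∈ Finset.range N, (1 + x * (x * y) ^ n)) * (∏ n ∈ Finset.range N, (1 + y * (x * y) ^ n)) =
      ∑ p ∈ antidiagonal (2 * N), gaussBinom (x * y) p.1 p.2 *
        (x ^ triangular (p.1 - N) * y ^ triangular (-(p.1 - N))) := by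
  set q := x * y with hq
  -- Apply the `q`-binomial theorem to the factors `x q ^ N + q ^ i` for `1 ≤ i ≤ 2 N`.
  have hscale : q ^ triangular N * (x * q ^ N) ^ N ≠ 0 := by positivity
  apply mul_left_cancel₀ hscale
  have hlow : ∏ i ∈ Finset.range N, (x * q ^ N + 1 * q ^ (i + 1)) =
      q ^ triangular N * ∏ n ∈ Finset.range N, (1 + x * q ^ n) := by
    rw [← prod_range_pow_succ, ← Finset.prod_range_reflect (fun i ↦ 1 + x * q ^ i),
      ← Finset.prod_mul_distrib]
    refine Finset.prod_congr rfl fun i hi ↦ ?_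
    have hN : N = i + 1 + (N - 1 - i) := by have := Finset.mem_range.mp hi; lia
    conv_lhs => rw [hN, pow_add]
    ring
  have hhigh : ∏ i ∈ Finset.range N, (x * q ^ N + 1 * q ^ (N + i + 1)) =
      (x * q ^ N) ^ N * ∏ n ∈ Finset.range N, (1 + y * q ^ n) := by
    have hfactor (i : ℕ) : x * q ^ N + 1 * q ^ (N + i + 1) = x * q ^ N * (1 + y * q ^ i) := by
      rw [hq]
      ring
    simp only [hfactor, Finset.prod_mul_distrib, Finset.prod_const, Finset.card_range, mul_pow]
  calc _ = ∏ i ∈ Finset.range (2 * N), (x * q ^ N + 1 * q ^ (i + 1)) := by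
        rw [two_mul, Finset.prod_range_add, hlow, hhigh]
        ring
    _ = _ := by
        rw [q_binomial_theorem, Finset.mul_sum]
        refine Finset.sum_congr rfl fun p hp ↦ ?_
        rw [one_pow, mul_one, triple_product_term x y _ (mem_antidiagonal.mp hp)]

theorem sum_antidiagonal_two_mul {M : Type*} [AddCommMonoid M] (f : ℤ → M) (N : ℕ) :
    ∑ p ∈ antidiagonal (2 * N), f (p.1 - N) = ∑ n ∈ Finset.Icc (-N : ℤ) N, f n := by
  refine Finset.sum_nbij' (fun p ↦ (p.1 - N : ℤ)) (fun n ↦ ((N + n).toNat, (N - n).toNat))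
    ?_ ?_ ?_ ?_ fun _ _ ↦ rfl
  all_goals simp only [mem_antidiagonal, Finset.mem_Icc, Prod.forall, Prod.mk.injEq]; lia

end QBinomial

section ModXPow
variable {R : Type*} [CommRing R]

/-- Reduction of power series modulo `X ^ d`. -/
noncomputable def modXPow (R : Type*) [CommRing R] (d : ℕ) :
    R⟦X⟧ →+* R⟦X⟧ ⧸ Ideal.span {(X ^ d : R⟦X⟧)} :=
  Ideal.Quotient.mk _

theorem modXPow_eq_iff {d : ℕ} {f g : R⟦X⟧} : modXPow R d f = modXPow R d g ↔ X ^ d ∣ f - g := by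
  rw [modXPow, Ideal.Quotient.eq, Ideal.mem_span_singleton]

theorem eq_of_forall_modXPow_eq {f g : R⟦X⟧} (h : ∀ d, modXPow R d f = modXPow R d g) : f = g := by
  ext d
  rw [← sub_eq_zero, ← map_sub]
  exact X_pow_dvd_iff.mp (modXPow_eq_iff.mp (h (d + 1))) d d.lt_succ_self

variable [TopologicalSpace R] [T2Space R] [IsTopologicalRing R]

theorem modXPow_qProd {d a b N : ℕ} [NeZero a] (hd : d ≤ a * N + b) (c : R) :
    modXPow R d (qProd c a b) =
      modXPow R d (∏ n ∈ Finset.range N, (1 + C c * X ^ (a * n + b))) := by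
  have htail : modXPow R d (qProd c a (a * N + b)) = modXPow R d 1 :=
    modXPow_eq_iff.mpr (X_pow_dvd_qProd_sub_one hd c)
  rw [qProd_eq_prod_range_mul c a b N, map_mul, htail, map_one, mul_one]

theorem modXPow_qProd_mul_gaussBinom {d m j : ℕ} (hm : d ≤ m) (hj : d ≤ j) (k : ℕ) [NeZero k] :
    modXPow R d (qProd (-1) k k * gaussBinom (X ^ k) m j) = 1 := by
  have hprod {N : ℕ} (hN : d ≤ N) : modXPow R d (∏ i ∈ Finset.range N, (1 - (X ^ k) ^ (i + 1))) =
      modXPow R d (qProd (-1) k k) := by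
    rw [modXPow_qProd (N := N) (by nlinarith [NeZero.pos k])]
    refine congrArg _ (Finset.prod_congr rfl fun i _ ↦ ?_)
    rw [map_neg, map_one, ← pow_mul]
    ring
  have hunit : IsUnit (modXPow R d (qProd (-1) k k)) := by
    refine (isUnit_iff_constantCoeff.mpr ?_).map _
    rw [constantCoeff_qProd]
    exact isUnit_one
  have h := congrArg (modXPow R d) (gaussBinom_mul (X ^ k : R⟦X⟧) m j)
  rw [map_mul, map_mul, hprod hm, hprod hj, hprod (hm.trans (m.le_add_right j))] at h
  rw [map_mul, mul_comm]
  exact hunit.mul_right_cancel (h.trans (one_mul _).symm)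

end ModXPow

section Theta

/-- The exponent of the `n`-th term of the theta series `theta z a b`. -/
def thetaExp (a b : ℕ) (n : ℤ) : ℕ := a * triangular n + b * triangular (-n)

theorem two_mul_thetaExp (a b : ℕ) (n : ℤ) :
    2 * (thetaExp a b n : ℤ) = (a + b) * n ^ 2 + (a - b) * n := by
  have hpos := two_mul_triangular n
  have hneg := two_mul_triangular (-n)
  rw [thetaExp]
  push_cast
  linear_combination (a : ℤ) * hpos + b * hneg

theorem natAbs_le_thetaExp_add_one {a b : ℕ} (hab : 0 < a + b) (n : ℤ) :
    n.natAbs ≤ thetaExp a b n + 1 := by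
  have hpos := two_mul_triangular n
  have hneg := two_mul_triangular (-n)
  have hmin : min (triangular n) (triangular (-n)) ≤ thetaExp a b n := by
    rw [thetaExp]
    rcases Nat.eq_zero_or_pos a with rfl | ha
    · nlinarith [min_le_right (triangular n) (triangular (-n))]
    · nlinarith [min_le_left (triangular n) (triangular (-n))]
  have hn : n.natAbs ≤ min (triangular n) (triangular (-n)) + 1 := by
    rw [← min_add_add_right, le_min_iff]
    constructor <;> zify <;> rcases abs_cases n with h | h <;> nlinarith
  lia

variable {R : Type*} [CommRing R]

theorem C_mul_X_pow_triangular (z : Rˣ) (a b : ℕ) (n : ℤ) :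
    (C (z : R) * X ^ a) ^ triangular n * (C (↑z⁻¹ : R) * X ^ b) ^ triangular (-n) =
      C ((z ^ n : Rˣ) : R) * X ^ thetaExp a b n := by
  have hn : (triangular n : ℤ) - triangular (-n) = n := by
    linarith [two_mul_triangular n, two_mul_triangular (-n)]
  have hz : ((z ^ n : Rˣ) : R) = z ^ triangular n * (↑z⁻¹ : R) ^ triangular (-n) := by
    conv_lhs => rw [← hn, zpow_sub, zpow_natCast, zpow_natCast, ← inv_pow]
    push_cast
    rfl
  rw [hz, thetaExp, map_mul, map_pow, map_pow]
  ring

theorem coeff_theta_term_eq_zero {a b : ℕ} (hab : 0 < a + b) (z : Rˣ) {i N : ℕ} (hi : i < N)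
    {n : ℤ} (hn : n ∉ Finset.Icc (-N : ℤ) N) :
    coeff i (C ((z ^ n : Rˣ) : R) * X ^ thetaExp a b n) = 0 := by
  have hexp := natAbs_le_thetaExp_add_one hab n
  rw [Finset.mem_Icc] at hn
  rw [coeff_C_mul_X_pow, if_neg (by lia)]

variable [TopologicalSpace R]

/-- Ramanujan's theta series `f (z X ^ a, z⁻¹ X ^ b)`, that is, the sum of
`z ^ n X ^ (a n (n + 1) / 2 + b n (n - 1) / 2)` over all integers `n`. -/
noncomputable def theta (z : Rˣ) (a b : ℕ) : R⟦X⟧ :=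
  ∑' n : ℤ, C ((z ^ n : Rˣ) : R) * X ^ thetaExp a b n

theorem hasSum_theta {a b : ℕ} (hab : 0 < a + b) (z : Rˣ) :
    HasSum (fun n : ℤ ↦ C ((z ^ n : Rˣ) : R) * X ^ thetaExp a b n) (theta z a b) :=
  ((summable_iff_summable_coeff R).mpr fun i ↦ summable_of_ne_finset_zero
    fun _ hn ↦ coeff_theta_term_eq_zero hab z i.lt_succ_self hn).hasSum

theorem theta_symm (z : Rˣ) (a b : ℕ) : theta z⁻¹ b a = theta z a b := by
  rw [theta, theta, ← (Equiv.neg ℤ).tsum_eq]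
  simp only [Equiv.neg_apply, inv_zpow', neg_neg, thetaExp, add_comm]

variable [T2Space R]

theorem modXPow_theta {a b : ℕ} (hab : 0 < a + b) (z : Rˣ) {d N : ℕ} (hd : d ≤ N) :
    modXPow R d (theta z a b) =
      modXPow R d (∑ n ∈ Finset.Icc (-N : ℤ) N, C ((z ^ n : Rˣ) : R) * X ^ thetaExp a b n) := by
  rw [modXPow_eq_iff, X_pow_dvd_iff]
  intro i hi
  have hcoeff := (hasSum_iff_hasSum_coeff R).mp (hasSum_theta hab z) i
  rw [map_sub, map_sum, sub_eq_zero]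
  exact hcoeff.unique (hasSum_sum_of_ne_finset_zero fun _ hn ↦
    coeff_theta_term_eq_zero hab z (hi.trans_le hd) hn)

theorem expand_theta {a b : ℕ} (hab : 0 < a + b) (m : ℕ) [NeZero m] (z : Rˣ) :
    expand m (NeZero.ne m) (theta z a b) = theta z (m * a) (m * b) := by
  rw [theta, (hasSum_theta hab z).summable.map_tsum _ (continuous_expand _), theta]
  simp only [map_mul, map_pow, expand_C, expand_X, ← pow_mul, thetaExp, mul_add, mul_assoc]

variable [IsTopologicalRing R]

theorem rescale_neg_one_theta {a b : ℕ} (ha : Odd a) (hb : Odd b) (z : Rˣ) :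
    rescale (-1) (theta z a b) = theta (-z) a b := by
  have hsign (n : ℤ) : (-1 : Rˣ) ^ n = (-1) ^ thetaExp a b n := by
    obtain ⟨a, rfl⟩ := ha
    obtain ⟨b, rfl⟩ := hb
    have hdiff : (thetaExp (2 * a + 1) (2 * b + 1) n : ℤ) =
        n + 2 * (a * triangular n + (b + 1) * triangular (-n)) := by
      rw [thetaExp]
      push_cast
      linarith [two_mul_triangular n, two_mul_triangular (-n)]
    rw [← zpow_natCast, hdiff, zpow_add, (even_two_mul _).neg_one_zpow, mul_one]
  rw [theta, (hasSum_theta (by have := ha.pos; lia) z).summable.map_tsum _ (continuous_rescale _),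
    theta]
  refine tsum_congr fun n ↦ ?_
  rw [rescale_C_mul_X_pow, ← neg_one_mul z, mul_zpow, hsign]
  simp [mul_comm]

theorem modXPow_qProd_mul_gaussBinom_mul_X_pow {a b d m k : ℕ} [NeZero (a + b)]
    (hmk : m + k = 2 * (2 * d)) (c : R) :
    modXPow R d (qProd (-1) (a + b) (a + b) * gaussBinom (X ^ (a + b)) m k *
      (C c * X ^ thetaExp a b (m - (2 * d : ℕ)))) =
        modXPow R d (C c * X ^ thetaExp a b (m - (2 * d : ℕ))) := by
  rw [map_mul]
  by_cases hd : d ≤ thetaExp a b (m - (2 * d : ℕ))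
  · have hzero : modXPow R d (C c * X ^ thetaExp a b (m - (2 * d : ℕ))) = 0 := by
      rw [← map_zero (modXPow R d), modXPow_eq_iff, sub_zero]
      exact (pow_dvd_pow X hd).mul_left _
    rw [hzero, mul_zero]
  · have := natAbs_le_thetaExp_add_one (NeZero.pos (a + b)) (m - (2 * d : ℕ))
    rw [modXPow_qProd_mul_gaussBinom (by lia) (by lia), one_mul]

theorem jacobi_triple_product [IsDomain R] {a b : ℕ} [NeZero (a + b)] (z : Rˣ) :
    qProd (-1) (a + b) (a + b) * qProd (z : R) (a + b) a * qProd (↑z⁻¹ : R) (a + b) b =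
      theta z a b := by
  refine eq_of_forall_modXPow_eq fun d ↦ ?_
  set N := 2 * d with hN
  set x : R⟦X⟧ := C (z : R) * X ^ a with hx
  set y : R⟦X⟧ := C (↑z⁻¹ : R) * X ^ b with hy
  have hx₀ : x ≠ 0 := mul_ne_zero (z.isUnit.map C).ne_zero (pow_ne_zero _ X_ne_zero)
  have hy₀ : y ≠ 0 := mul_ne_zero (z⁻¹.isUnit.map C).ne_zero (pow_ne_zero _ X_ne_zero)
  have hxy : x * y = X ^ (a + b) := by
    rw [hx, hy, mul_mul_mul_comm, ← map_mul, Units.mul_inv, map_one, one_mul, pow_add]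
  have hprod (c : R) (e : ℕ) : modXPow R d (qProd c (a + b) e) =
      modXPow R d (∏ n ∈ Finset.range N, (1 + C c * X ^ e * (x * y) ^ n)) := by
    rw [modXPow_qProd (N := N) (by have := NeZero.pos (a + b); nlinarith), hxy]
    refine congrArg _ (Finset.prod_congr rfl fun i _ ↦ ?_)
    ring
  have hterm : ∀ p ∈ antidiagonal (2 * N),
      modXPow R d (qProd (-1) (a + b) (a + b) * (gaussBinom (x * y) p.1 p.2 *
        (x ^ triangular (p.1 - N) * y ^ triangular (-(p.1 - N))))) =
      modXPow R d (C ((z ^ (p.1 - N : ℤ) : Rˣ) : R) * X ^ thetaExp a b (p.1 - N)) := by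
    intro p hp
    rw [C_mul_X_pow_triangular, ← mul_assoc, hxy,
      modXPow_qProd_mul_gaussBinom_mul_X_pow (mem_antidiagonal.mp hp)]
  rw [mul_assoc, map_mul, map_mul _ (qProd _ _ a), hprod _ a, hprod _ b, ← map_mul, ← map_mul,
    finite_triple_product hx₀ hy₀, Finset.mul_sum, map_sum, Finset.sum_congr rfl hterm, ← map_sum,
    sum_antidiagonal_two_mul (fun n ↦ C ((z ^ n : Rˣ) : R) * X ^ thetaExp a b n),
    modXPow_theta (NeZero.pos _) z (show d ≤ N by lia)]

/-- Dissection of a theta series by the residue of the summation index modulo `m`; the shifts `s r`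
leave room to make all exponents `a' r` and `b' r` nonnegative. -/
theorem theta_eq_sum (m : ℕ) [NeZero m] {a b : ℕ} (hab : 0 < a + b) (z : Rˣ) {s : Fin m → ℤ}
    {e a' b' : Fin m → ℕ} (hab' : ∀ r, 0 < a' r + b' r)
    (hexp : ∀ r (j : ℤ), (a + b) * (m * (j + s r) + r) ^ 2 + (a - b) * (m * (j + s r) + r) =
      2 * (e r : ℤ) + ((a' r + b' r) * j ^ 2 + (a' r - b' r) * j)) :
    theta z a b = ∑ r, C ((z ^ (m * s r + r : ℤ) : Rˣ) : R) * X ^ e r *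
      theta (z ^ m) (a' r) (b' r) := by
  let index : Fin m × ℤ ≃ ℤ := (Equiv.prodShear (Equiv.refl _) fun r ↦ Equiv.addRight (s r)).trans
    ((Equiv.prodComm _ _).trans (Int.divModEquiv m).symm)
  have h := hasSum_theta hab z
  rw [← index.hasSum_iff] at h
  have hfiber := h.prod_fiberwise (g := fun r ↦ C ((z ^ (m * s r + r : ℤ) : Rˣ) : R) * X ^ e r *
      theta (z ^ m) (a' r) (b' r)) fun r ↦ by
    refine ((hasSum_theta (hab' r) (z ^ m)).mul_left _).congr_fun fun j ↦ ?_
    have hindex : index (r, j) = m * (j + s r) + r := by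
      simp [index, mul_comm]
    have hz : z ^ (m * (j + s r) + r : ℤ) = z ^ (m * s r + r : ℤ) * (z ^ m) ^ j := by
      rw [← zpow_natCast z m, ← zpow_mul, ← zpow_add]
      ring_nf
    have he : thetaExp a b (m * (j + s r) + r) = e r + thetaExp (a' r) (b' r) j := by
      zify
      linarith [hexp r j, two_mul_thetaExp a b (m * (j + s r) + r),
        two_mul_thetaExp (a' r) (b' r) j]
    rw [Function.comp_apply, hindex, he, hz, Units.val_mul, map_mul, pow_add]
    ring
  exact hfiber.unique (hasSum_fintype _)

end Theta

section ThetaProducts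
variable {R : Type*} [CommRing R] [IsDomain R] [TopologicalSpace R] [T2Space R]
  [IsTopologicalRing R]

theorem theta_mul_sq (z : Rˣ) (hz : z⁻¹ = z) (k : ℕ) [NeZero k] :
    theta z k k * qProd (z : R) (2 * k) (2 * k) ^ 2 =
      qProd (-1) (2 * k) (2 * k) * qProd (z : R) k k ^ 2 := by
  have : NeZero (k + k) := ⟨by have := NeZero.ne k; lia⟩
  rw [← jacobi_triple_product, hz, qProd_self_eq_prod_mul (z : R) 1 k, ← two_mul]
  simp only [Finset.prod_range_succ, Finset.prod_range_zero, Nat.reduceAdd]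
  ring_nf

theorem theta_two_mul_mul (z : Rˣ) (hz : z⁻¹ = z) (k : ℕ) [NeZero k] :
    theta z (2 * k) k * qProd (z : R) (3 * k) (3 * k) =
      qProd (-1) (3 * k) (3 * k) * qProd (z : R) k k := by
  have : NeZero (2 * k + k) := ⟨by have := NeZero.ne k; lia⟩
  rw [← jacobi_triple_product, hz, qProd_self_eq_prod_mul (z : R) 2 k,
    show 2 * k + k = 3 * k by ring]
  simp only [Finset.prod_range_succ, Finset.prod_range_zero, ← mul_assoc, Nat.reduceAdd]
  ring_nf

theorem theta_three_mul_mul (z : Rˣ) (hz : z⁻¹ = z) (k : ℕ) [NeZero k] :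
    theta z (3 * k) k * qProd (z : R) (2 * k) (2 * k) =
      qProd (-1) (4 * k) (4 * k) * qProd (z : R) k k := by
  have : NeZero (3 * k + k) := ⟨by have := NeZero.ne k; lia⟩
  rw [← jacobi_triple_product, hz, qProd_self_eq_prod_mul (z : R) 3 k,
    qProd_self_eq_prod_mul (z : R) 1 (2 * k), show 3 * k + k = 4 * k by ring]
  simp only [Finset.prod_range_succ, Finset.prod_range_zero, ← mul_assoc, Nat.reduceAdd,
    Nat.reduceMul]
  ring_nf

theorem theta_five_mul_mul (z : Rˣ) (hz : z⁻¹ = z) (k : ℕ) [NeZero k] :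
    theta z (5 * k) k * (qProd (z : R) (2 * k) (2 * k) * qProd (z : R) (3 * k) (3 * k)) =
      qProd (-1) (6 * k) (6 * k) * (qProd (z : R) k k * qProd (z : R) (6 * k) (6 * k)) := by
  have : NeZero (5 * k + k) := ⟨by have := NeZero.ne k; lia⟩
  rw [← jacobi_triple_product, hz, qProd_self_eq_prod_mul (z : R) 5 k,
    qProd_self_eq_prod_mul (z : R) 2 (2 * k), qProd_self_eq_prod_mul (z : R) 1 (3 * k),
    show 5 * k + k = 6 * k by ring]
  simp only [Finset.prod_range_succ, Finset.prod_range_zero, ← mul_assoc, Nat.reduceAdd,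
    Nat.reduceMul]
  ring_nf

end ThetaProducts

section EtaQuotients

/-- Euler's product `∏ (1 - X ^ (k n))` over `n ≥ 1`. -/
noncomputable def euler (k : ℕ) : ℤ⟦X⟧ := qProd (-1) k k

/-- The embedding of `ℤ⟦X⟧` into its fraction field, where quotients of Euler products live. -/
noncomputable def toFrac : ℤ⟦X⟧ →+* FractionRing ℤ⟦X⟧ := algebraMap _ _

theorem toFrac_injective : Function.Injective toFrac := IsFractionRing.injective _ _

/-- Euler's product as an element of the fraction field; it is Dedekind's `η (k τ)` without its
fractional power of `X = exp (2 π i τ)`. -/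
noncomputable def eta (k : ℕ) : FractionRing ℤ⟦X⟧ := toFrac (euler k)

theorem constantCoeff_euler (k : ℕ) [NeZero k] : constantCoeff (euler k) = 1 :=
  constantCoeff_qProd (-1) k k

theorem euler_ne_zero (k : ℕ) [NeZero k] : euler k ≠ 0 := fun h ↦ by
  simpa [h] using constantCoeff_euler k

theorem eta_ne_zero (k : ℕ) [NeZero k] : eta k ≠ 0 :=
  (map_ne_zero_iff _ toFrac_injective).mpr (euler_ne_zero k)

theorem toFrac_qProd_one (k : ℕ) [NeZero k] : toFrac (qProd 1 k k) = eta (2 * k) / eta k := by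
  have h := prod_qProd_primitiveRoot_pow (IsPrimitiveRoot.neg_one (R := ℤ) 0 (by decide)) k k
  rw [Finset.prod_range_succ, Finset.prod_range_one, pow_zero, pow_one, neg_neg] at h
  rw [eq_div_iff (eta_ne_zero k), eta, eta, euler, euler, ← map_mul, ← h, mul_comm]

theorem toFrac_qProd_neg_one (k : ℕ) : toFrac (qProd (-1) k k) = eta k := rfl

theorem toFrac_theta_neg_one_self (k : ℕ) [NeZero k] :
    toFrac (theta (-1) k k) = eta k ^ 2 / eta (2 * k) := by
  have h := congrArg toFrac (theta_mul_sq (-1 : ℤˣ) rfl k)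
  simp only [Units.val_neg, Units.val_one, map_mul, map_pow, toFrac_qProd_neg_one] at h
  field_simp [eta_ne_zero] at h ⊢
  exact h

theorem toFrac_theta_one_self (k : ℕ) [NeZero k] :
    toFrac (theta 1 k k) = eta (2 * k) ^ 5 / (eta k ^ 2 * eta (4 * k) ^ 2) := by
  have h := congrArg toFrac (theta_mul_sq (1 : ℤˣ) rfl k)
  simp only [Units.val_one, map_mul, map_pow, toFrac_qProd_one, toFrac_qProd_neg_one, ← mul_assoc,
    Nat.reduceMul] at h
  field_simp [eta_ne_zero] at h ⊢
  linear_combination h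

theorem toFrac_theta_one_two_mul (k : ℕ) [NeZero k] :
    toFrac (theta 1 (2 * k) k) = eta (2 * k) * eta (3 * k) ^ 2 / (eta k * eta (6 * k)) := by
  have h := congrArg toFrac (theta_two_mul_mul (1 : ℤˣ) rfl k)
  simp only [Units.val_one, map_mul, toFrac_qProd_one, toFrac_qProd_neg_one, ← mul_assoc,
    Nat.reduceMul] at h
  field_simp [eta_ne_zero] at h ⊢
  linear_combination h

theorem toFrac_theta_one_three_mul (k : ℕ) [NeZero k] :
    toFrac (theta 1 (3 * k) k) = eta (2 * k) ^ 2 / eta k := by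
  have h := congrArg toFrac (theta_three_mul_mul (1 : ℤˣ) rfl k)
  simp only [Units.val_one, map_mul, toFrac_qProd_one, toFrac_qProd_neg_one, ← mul_assoc,
    Nat.reduceMul] at h
  field_simp [eta_ne_zero] at h ⊢
  linear_combination h

theorem toFrac_theta_neg_one_five_mul (k : ℕ) [NeZero k] :
    toFrac (theta (-1) (5 * k) k) = eta k * eta (6 * k) ^ 2 / (eta (2 * k) * eta (3 * k)) := by
  have h := congrArg toFrac (theta_five_mul_mul (-1 : ℤˣ) rfl k)
  simp only [Units.val_neg, Units.val_one, map_mul, toFrac_qProd_neg_one] at h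
  field_simp [eta_ne_zero] at h ⊢
  linear_combination h

end EtaQuotients

section ThetaDissections
variable {R : Type*} [CommRing R] [TopologicalSpace R] [T2Space R] [IsTopologicalRing R]

theorem theta_neg_one_one_one :
    theta (-1 : Rˣ) 1 1 = theta (-1) 9 9 - X * (2 * theta (-1) 15 3) := by
  rw [theta_eq_sum 3 (by norm_num) (-1) (s := ![0, 0, -1]) (e := ![0, 1, 1]) (a' := ![9, 15, 3])
    (b' := ![9, 3, 15]) (by decide) fun r j ↦ ?_]
  · have hcube : (-1 : Rˣ) ^ 3 = -1 := Odd.neg_one_pow ⟨1, rfl⟩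
    simp [Fin.sum_univ_three, hcube, ← theta_symm (-1 : Rˣ) 3 15]
    ring
  · fin_cases r <;> simp <;> ring

theorem theta_one_three_one :
    theta (1 : Rˣ) 3 1 = theta 1 6 3 + X * theta 1 27 9 := by
  have hthird : theta (1 : Rˣ) 3 1 = theta 1 21 15 + X ^ 3 * theta 1 33 3 + X * theta 1 9 27 := by
    rw [theta_eq_sum 3 (by norm_num) 1 (s := ![0, 0, -1]) (e := ![0, 3, 1]) (a' := ![21, 33, 9])
      (b' := ![15, 3, 27]) (by decide) fun r j ↦ ?_]
    · simp [Fin.sum_univ_three]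
    · fin_cases r <;> simp <;> ring
  have hhalf : theta (1 : Rˣ) 6 3 = theta 1 21 15 + X ^ 3 * theta 1 3 33 := by
    rw [theta_eq_sum 2 (by norm_num) 1 (s := ![0, -1]) (e := ![0, 3]) (a' := ![21, 3])
      (b' := ![15, 33]) (by decide) fun r j ↦ ?_]
    · simp
    · fin_cases r <;> simp <;> ring
  rw [hthird, hhalf, ← theta_symm 1 33 3, ← theta_symm 1 9 27, inv_one]

theorem theta_one_one_one :
    theta (1 : Rˣ) 1 1 = theta 1 4 4 + 2 * X * theta 1 24 8 := by
  have heven : theta (1 : Rˣ) 1 1 = theta 1 4 4 + X * theta 1 8 0 := by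
    rw [theta_eq_sum 2 (by norm_num) 1 (s := ![0, 0]) (e := ![0, 1]) (a' := ![4, 8])
      (b' := ![4, 0]) (by decide) fun r j ↦ ?_]
    · simp
    · fin_cases r <;> simp <;> ring
  have hodd : theta (1 : Rˣ) 8 0 = theta 1 24 8 + theta 1 8 24 := by
    rw [theta_eq_sum 2 (by norm_num) 1 (s := ![0, -1]) (e := ![0, 0]) (a' := ![24, 8])
      (b' := ![8, 24]) (by decide) fun r j ↦ ?_]
    · simp
    · fin_cases r <;> simp <;> ring
  rw [heven, hodd, ← theta_symm 1 8 24, inv_one]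
  ring_nf

end ThetaDissections

section EulerNorms

theorem expand_euler (m : ℕ) [NeZero m] (k : ℕ) [NeZero k] :
    expand m (NeZero.ne m) (euler k) = euler (m * k) :=
  expand_qProd m (-1) k k

theorem rescale_neg_one_euler_mul {k : ℕ} [NeZero k] (hk : Odd k) :
    rescale (-1) (euler k) * (euler k * euler (4 * k)) = euler (2 * k) ^ 3 := by
  have h := cyclicNorm_qProd_mul_qProd Nat.prime_two
    (IsPrimitiveRoot.neg_one (R := ℤ) 0 (by decide)) hk.coprime_two_right
  rw [cyclicNorm_apply, Finset.prod_range_succ, Finset.prod_range_one, pow_zero, pow_one,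
    rescale_one, RingHom.id_apply, ← mul_assoc 2 2 k] at h
  rw [euler, euler, euler, ← h]
  ring_nf

theorem norm_mul_euler_pow {p : ℕ} (hp : p.Prime) {a b : ℤ⟦X⟧} {i j n : ℕ} [NeZero i]
    [NeZero j] (hi : i.Coprime p) (hj : j.Coprime p)
    (h : (expand p hp.ne_zero a - X * expand p hp.ne_zero b) * euler i = euler j ^ n) :
    (a ^ p - X * b ^ p) * euler i ^ (p + 1) * euler (p * j) ^ n =
      euler (p * i) * euler j ^ ((p + 1) * n) := by
  have := NeZero.mk hp.ne_zero
  let toComplex : ℤ⟦X⟧ →+* ℂ⟦X⟧ := map (Int.castRingHom ℂ)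
  have hinjective : Function.Injective toComplex := map_injective _ Int.cast_injective
  obtain ⟨ζ, hζ⟩ : ∃ ζ : ℂ, IsPrimitiveRoot ζ p := ⟨_, Complex.isPrimitiveRoot_exp p hp.ne_zero⟩
  have heuler (k : ℕ) [NeZero k] : toComplex (euler k) = qProd (-1) k k := by
    have := map_qProd (f := Int.castRingHom ℂ) continuous_of_discreteTopology (-1) k k
    simpa [toComplex, euler] using this
  have hnormᵢ : cyclicNorm ζ p (qProd (-1) i i) * _ = _ := cyclicNorm_qProd_mul_qProd hp hζ hi
  have hnormⱼ : cyclicNorm ζ p (qProd (-1) j j) * _ = _ := cyclicNorm_qProd_mul_qProd hp hζ hj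
  have hnorm := congrArg (cyclicNorm ζ p ∘ toComplex) h
  simp only [Function.comp_apply, map_mul, map_pow, map_sub, heuler, toComplex, map_expand, map_X,
    cyclicNorm_expand_sub hp.ne_zero hζ] at hnorm
  apply hinjective
  apply expand_injective hp.ne_zero
  simp only [map_mul, map_pow, heuler, expand_qProd, pow_mul, ← hnormᵢ, ← hnormⱼ, mul_pow, ← hnorm]
  simp only [toComplex, map_sub, map_mul, map_pow, map_X]
  ring

end EulerNorms

section ThetaIdentities

theorem theta_neg_one_mul_euler (k : ℕ) [NeZero k] :
    theta (-1 : ℤˣ) k k * euler (2 * k) = euler k ^ 2 := by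
  apply toFrac_injective
  rw [map_mul, toFrac_theta_neg_one_self, map_pow]
  exact div_mul_cancel₀ _ (eta_ne_zero (2 * k))

theorem theta_one_three_mul_mul_euler (k : ℕ) [NeZero k] :
    theta (1 : ℤˣ) (3 * k) k * euler k = euler (2 * k) ^ 2 := by
  apply toFrac_injective
  rw [map_mul, toFrac_theta_one_three_mul, map_pow]
  exact div_mul_cancel₀ _ (eta_ne_zero k)

theorem theta_neg_one_pow_four :
    theta (-1 : ℤˣ) 1 1 ^ 4 =
      theta (-1) 3 3 ^ 4 - 8 * X * theta (-1) 5 1 ^ 3 * theta (-1) 3 3 := by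
  have hdissect : (expand 3 three_ne_zero (theta (-1 : ℤˣ) 3 3) -
      X * expand 3 three_ne_zero (2 * theta (-1) 5 1)) * euler 2 = euler 1 ^ 2 := by
    rw [map_mul, map_ofNat, expand_theta (by norm_num), expand_theta (by norm_num),
      ← theta_neg_one_one_one]
    exact theta_neg_one_mul_euler 1
  have hnorm := congrArg toFrac
    (norm_mul_euler_pow Nat.prime_three (i := 2) (j := 1) (by norm_num) (by norm_num) hdissect)
  apply toFrac_injective
  simp only [map_mul, map_sub, map_pow, map_ofNat, ← eta.eq_1, Nat.reduceAdd, Nat.reduceMul,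
    toFrac_theta_neg_one_self 1, toFrac_theta_neg_one_self 3,
    toFrac_theta_neg_one_five_mul 1] at hnorm ⊢
  field_simp [eta_ne_zero] at hnorm ⊢
  linear_combination -hnorm

theorem theta_one_three_one_pow_four :
    theta (1 : ℤˣ) 3 1 ^ 4 = theta 1 2 1 ^ 3 * theta 1 9 3 + X * theta 1 9 3 ^ 4 := by
  have hdissect : (expand 3 three_ne_zero (theta (1 : ℤˣ) 2 1) -
      X * expand 3 three_ne_zero (-theta 1 9 3)) * euler 1 = euler 2 ^ 2 := by
    rw [map_neg, mul_neg, sub_neg_eq_add, expand_theta (by norm_num), expand_theta (by norm_num),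
      ← theta_one_three_one]
    exact theta_one_three_mul_mul_euler 1
  have hnorm := congrArg toFrac
    (norm_mul_euler_pow Nat.prime_three (i := 1) (j := 2) (by norm_num) (by norm_num) hdissect)
  apply toFrac_injective
  simp only [map_mul, map_sub, map_add, map_neg, map_pow, ← eta.eq_1, Nat.reduceAdd, Nat.reduceMul,
    toFrac_theta_one_three_mul 1, toFrac_theta_one_three_mul 3,
    toFrac_theta_one_two_mul 1] at hnorm ⊢
  field_simp [eta_ne_zero] at hnorm ⊢
  linear_combination -hnorm

theorem theta_one_mul_theta_neg_one (k : ℕ) [NeZero k] :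
    theta (1 : ℤˣ) k k * theta (-1) k k = theta (-1) (2 * k) (2 * k) ^ 2 := by
  apply toFrac_injective
  simp only [map_mul, map_pow, toFrac_theta_one_self, toFrac_theta_neg_one_self, ← mul_assoc,
    Nat.reduceMul]
  field_simp [eta_ne_zero]

theorem theta_one_mul_theta_one_three_mul (k : ℕ) [NeZero k] :
    theta (1 : ℤˣ) k k * theta 1 (3 * (2 * k)) (2 * k) = theta 1 (3 * k) k ^ 2 := by
  apply toFrac_injective
  rw [map_mul, map_pow, toFrac_theta_one_self, toFrac_theta_one_three_mul,
    toFrac_theta_one_three_mul, ← mul_assoc 2 2 k]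
  simp only [Nat.reduceMul]
  field_simp [eta_ne_zero]

theorem theta_neg_one_eq_sub :
    theta (-1 : ℤˣ) 1 1 = theta 1 4 4 - 2 * X * theta 1 24 8 := by
  have h := congrArg (rescale (-1)) (theta_one_one_one (R := ℤ))
  have heven (a b : ℕ) (hab : 0 < a + b) :
      rescale (-1) (theta (1 : ℤˣ) (2 * a) (2 * b)) = theta 1 (2 * a) (2 * b) := by
    rw [← expand_theta hab, rescale_expand _ (by norm_num)]
  rw [rescale_neg_one_theta odd_one odd_one, map_add, map_mul, map_mul, heven 2 2 (by norm_num),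
    heven 12 4 (by norm_num), rescale_X, map_ofNat, map_neg, map_one] at h
  linear_combination h

theorem theta_neg_one_sq :
    theta (-1 : ℤˣ) 1 1 ^ 2 = theta 1 2 2 ^ 2 - 4 * X * theta 1 12 4 ^ 2 := by
  apply expand_injective two_ne_zero
  simp only [map_sub, map_mul, map_pow, map_ofNat, expand_X,
    expand_theta (by norm_num : 0 < 1 + 1), expand_theta (by norm_num : 0 < 2 + 2),
    expand_theta (by norm_num : 0 < 12 + 4)]
  rw [← theta_one_mul_theta_neg_one, theta_neg_one_eq_sub, theta_one_one_one]
  ring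

theorem theta_one_sq :
    theta (1 : ℤˣ) 1 1 ^ 2 = theta 1 2 2 ^ 2 + 4 * X * theta 1 12 4 ^ 2 := by
  calc theta (1 : ℤˣ) 1 1 ^ 2
      = theta (-1) 1 1 ^ 2 + 8 * X * (theta 1 4 4 * theta 1 24 8) := by
        rw [theta_one_one_one, theta_neg_one_eq_sub]
        ring
    _ = theta 1 2 2 ^ 2 + 4 * X * theta 1 12 4 ^ 2 := by
      rw [theta_neg_one_sq, theta_one_mul_theta_one_three_mul 4]
      ring

theorem theta_one_pow_four_sub_theta_neg_one_pow_four :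
    theta (1 : ℤˣ) 1 1 ^ 4 - theta (-1) 1 1 ^ 4 = 16 * X * theta 1 6 2 ^ 4 := by
  have h := theta_one_mul_theta_one_three_mul 2
  calc theta (1 : ℤˣ) 1 1 ^ 4 - theta (-1) 1 1 ^ 4
      = (theta 1 1 1 ^ 2) ^ 2 - (theta (-1) 1 1 ^ 2) ^ 2 := by ring
    _ = 16 * X * (theta 1 2 2 * theta 1 12 4) ^ 2 := by
      rw [theta_one_sq, theta_neg_one_sq]
      ring
    _ = 16 * X * theta 1 6 2 ^ 4 := by rw [h, ← pow_mul]

end ThetaIdentities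

section Slices
variable {R : Type*} [CommRing R]

/-- The series `∑ a (m n + r) X ^ n` extracted from `∑ a n X ^ n`. -/
noncomputable def slice (m r : ℕ) : R⟦X⟧ →ₗ[R] R⟦X⟧ where
  toFun f := PowerSeries.mk fun n ↦ coeff (m * n + r) f
  map_add' f g := by ext; simp
  map_smul' c f := by ext; simp

theorem coeff_slice (m r n : ℕ) (f : R⟦X⟧) : coeff n (slice m r f) = coeff (m * n + r) f :=
  coeff_mk n fun n ↦ coeff (m * n + r) f

theorem slice_slice (m r m' r' : ℕ) (f : R⟦X⟧) :
    slice m r (slice m' r' f) = slice (m' * m) (m' * r + r') f := by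
  ext n
  simp only [coeff_slice, mul_add, mul_assoc, add_assoc]

theorem slice_mul_expand {m r : ℕ} (hr : r < m) (f g : R⟦X⟧) :
    slice m r (f * expand m (by lia) g) = slice m r f * g := by
  ext n
  rw [coeff_slice, coeff_mul, coeff_mul]
  refine (Finset.sum_of_injOn (fun x ↦ (m * x.1 + r, m * x.2)) ?_ ?_ ?_ ?_).symm
  · rintro ⟨i, j⟩ - ⟨i', j'⟩ - h
    have hm : m ≠ 0 := by lia
    simpa [hm] using h
  · rintro ⟨i, j⟩ h
    rw [Finset.mem_coe, mem_antidiagonal] at h ⊢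
    rw [← h]
    ring
  · rintro ⟨i, j⟩ hij hnot
    rw [coeff_expand_of_not_dvd, mul_zero]
    rintro ⟨j, rfl⟩
    rw [mem_antidiagonal] at hij
    have hj : j ≤ n := by
      by_contra! hlt
      nlinarith
    obtain ⟨k, rfl⟩ := Nat.exists_eq_add_of_le' hj
    refine hnot ⟨(k, j), Finset.mem_coe.mpr (mem_antidiagonal.mpr rfl), ?_⟩
    simp only [Prod.mk.injEq, and_true]
    lia
  · rintro ⟨i, j⟩ -
    rw [coeff_slice, coeff_expand_mul]

theorem slice_succ_X_mul (m r : ℕ) (f : R⟦X⟧) : slice m (r + 1) (X * f) = slice m r f := by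
  ext n
  rw [coeff_slice, coeff_slice, ← add_assoc, coeff_succ_X_mul]

theorem slice_expand_of_not_dvd {m r k : ℕ} (hk : k ≠ 0) (h : ∀ n, ¬ k ∣ m * n + r) (f : R⟦X⟧) :
    slice m r (expand k hk f) = 0 := by
  ext n
  rw [coeff_slice, coeff_expand_of_not_dvd k hk f (h n), map_zero]

theorem slice_two_zero_expand_add (f g : R⟦X⟧) :
    slice 2 0 (expand 2 two_ne_zero f + X * expand 2 two_ne_zero g) = f := by
  ext n
  rw [coeff_slice, map_add, add_zero, coeff_expand_mul]
  rcases n with - | n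
  · rw [mul_zero, coeff_zero_X_mul, add_zero]
  · rw [mul_add_one, coeff_succ_X_mul, coeff_expand_of_not_dvd _ _ _ (by lia), add_zero]

theorem slice_two_one_expand_add (f g : R⟦X⟧) :
    slice 2 1 (expand 2 two_ne_zero f + X * expand 2 two_ne_zero g) = g := by
  ext n
  rw [coeff_slice, map_add, coeff_succ_X_mul, coeff_expand_mul,
    coeff_expand_of_not_dvd _ _ _ (by lia), zero_add]

theorem expand_slice_add (f : R⟦X⟧) :
    expand 2 two_ne_zero (slice 2 0 f) + X * expand 2 two_ne_zero (slice 2 1 f) = f := by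
  ext n
  obtain ⟨n, rfl | rfl⟩ := n.even_or_odd'
  · rw [← add_zero (2 * n), ← coeff_slice, slice_two_zero_expand_add, coeff_slice]
  · rw [← coeff_slice, slice_two_one_expand_add, coeff_slice]

theorem expand_slice_sub (f : R⟦X⟧) :
    expand 2 two_ne_zero (slice 2 0 f) - X * expand 2 two_ne_zero (slice 2 1 f) =
      rescale (-1) f := by
  conv_rhs => rw [← expand_slice_add f]
  rw [map_add, map_mul, rescale_X, rescale_expand _ (by norm_num), rescale_expand _ (by norm_num),
    map_neg, map_one, neg_one_mul, neg_mul, sub_eq_add_neg]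

end Slices

section Divisibility
variable {R : Type*} [CommRing R]

theorem natCast_dvd_iff_forall_coeff {d : ℕ} {f : R⟦X⟧} :
    (d : R⟦X⟧) ∣ f ↔ ∀ n, (d : R) ∣ coeff n f := by
  rw [← map_natCast C]
  refine ⟨fun ⟨g, hg⟩ n ↦ ⟨coeff n g, by rw [hg, coeff_C_mul]⟩, fun h ↦ ?_⟩
  choose g hg using h
  refine ⟨PowerSeries.mk g, ?_⟩
  ext n
  rw [hg, coeff_C_mul, coeff_mk]

theorem ofNat_dvd_iff_forall_coeff {d : ℕ} [d.AtLeastTwo] {f : R⟦X⟧} :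
    (ofNat(d) : R⟦X⟧) ∣ f ↔ ∀ n, (ofNat(d) : R) ∣ coeff n f := by
  simpa only [Nat.cast_ofNat] using natCast_dvd_iff_forall_coeff (d := ofNat(d))

theorem dvd_slice {d : ℕ} [d.AtLeastTwo] (m r : ℕ) {f : R⟦X⟧} (h : (ofNat(d) : R⟦X⟧) ∣ f) :
    (ofNat(d) : R⟦X⟧) ∣ slice m r f := by
  rw [ofNat_dvd_iff_forall_coeff] at h ⊢
  simpa only [coeff_slice] using fun n ↦ h (m * n + r)

theorem dvd_slice_iff_of_dvd_sub {d : ℕ} [d.AtLeastTwo] (m r : ℕ) {f g : R⟦X⟧}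
    (h : (ofNat(d) : R⟦X⟧) ∣ f - g) :
    (ofNat(d) : R⟦X⟧) ∣ slice m r f ↔ (ofNat(d) : R⟦X⟧) ∣ slice m r g :=
  dvd_iff_dvd_of_dvd_sub (by simpa only [map_sub] using dvd_slice m r h)

theorem slice_ofNat_mul (d : ℕ) [d.AtLeastTwo] (m r : ℕ) (f : R⟦X⟧) :
    slice m r (ofNat(d) * f) = ofNat(d) * slice m r f := by
  rw [← map_ofNat C, ← smul_eq_C_mul, map_smul, smul_eq_C_mul]

theorem dvd_slice_expand {d m r m' r' k : ℕ} [d.AtLeastTwo] (hk : k ≠ 0)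
    (hmod : ∀ i, k * i ≡ r' [MOD m'] → i ≡ r [MOD m]) (hr : r < m) {f : R⟦X⟧}
    (h : (ofNat(d) : R⟦X⟧) ∣ slice m r f) : (ofNat(d) : R⟦X⟧) ∣ slice m' r' (expand k hk f) := by
  rw [ofNat_dvd_iff_forall_coeff] at h ⊢
  intro n
  rw [coeff_slice, coeff_expand]
  split_ifs with hdvd
  · obtain ⟨i, hi⟩ := hdvd
    have hir : i % m = r :=
      Nat.mod_eq_of_modEq (hmod i (hi ▸ Nat.mul_add_mod_self_left m' n r')) hr
    rw [hi, Nat.mul_div_cancel_left i (by lia), ← Nat.div_add_mod i m, hir, ← coeff_slice]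
    exact h _
  · exact dvd_zero _

theorem dvd_pow_sub_expand {p : ℕ} (hp : p.Prime) (f : ℤ⟦X⟧) :
    (p : ℤ⟦X⟧) ∣ f ^ p - expand p hp.ne_zero f := by
  have := Fact.mk hp
  have hfrob := MvPowerSeries.map_frobenius_expand (R := ZMod p) p hp.ne_zero
    (f := map (Int.castRingHom (ZMod p)) f)
  rw [ZMod.frobenius_zmod] at hfrob
  change map (RingHom.id (ZMod p)) (expand p _ (map (Int.castRingHom (ZMod p)) f)) = _ at hfrob
  rw [PowerSeries.map_id, id, ← map_expand, ← map_pow] at hfrob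
  refine natCast_dvd_iff_forall_coeff.mpr fun n ↦ ?_
  have hcoeff := congrArg (coeff n) hfrob
  rw [coeff_map, coeff_map, eq_intCast, eq_intCast] at hcoeff
  rw [← ZMod.intCast_zmod_eq_zero_iff_dvd, map_sub, Int.cast_sub, hcoeff, sub_self]

end Divisibility

section GeneratingFunction

/-- The generating function of `RD^{(l,t)}`. -/
noncomputable def rdSeries (l t : ℕ) : ℤ⟦X⟧ := PowerSeries.mk fun n ↦ (RD l t n : ℤ)

theorem hasProd_rdSeries (l t : ℕ) [NeZero t] :
    HasProd (fun i : ℕ ↦ if l ∣ i + 1 then 1 else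
      ∑ j ∈ Finset.range t, ((X : ℤ⟦X⟧) ^ (i + 1)) ^ j) (rdSeries l t) := by
  have hgen : rdSeries l t =
      Nat.Partition.genFun fun i c ↦ if ¬ l ∣ i ∧ c < t then (1 : ℤ) else 0 := by
    ext n
    rw [rdSeries, coeff_mk, Nat.Partition.coeff_genFun]
    simp_rw [RD, regularDistinct, Finset.card_filter, Finsupp.prod, Finset.prod_boole]
    simp [forall_and]
  rw [hgen]
  convert! Nat.Partition.hasProd_genFun (fun i c ↦ if ¬ l ∣ i ∧ c < t then (1 : ℤ) else 0) using 1
  funext i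
  by_cases h : l ∣ i + 1
  · simp only [h, not_true_eq_false, false_and, if_true, if_false]
    exact (add_eq_left.mpr ((tsum_congr fun _ ↦ zero_smul ℤ _).trans tsum_zero)).symm
  · rw [if_neg h, Finset.sum_range_eq_add_Ico _ (NeZero.pos t), pow_zero,
      Finset.sum_Ico_eq_sum_range]
    rw [tsum_eq_sum (s := Finset.range (t - 1)) fun c hc ↦ ?_]
    · refine congrArg (1 + ·) (Finset.sum_congr rfl fun c hc ↦ ?_)
      rw [Finset.mem_range] at hc
      rw [if_pos ⟨h, by lia⟩, ← pow_mul, add_comm 1 c]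
      exact (one_smul ℤ _).symm
    · rw [Finset.mem_range] at hc
      exact smul_eq_zero_of_left (if_neg (by lia)) _

theorem hasProd_euler (k : ℕ) [NeZero k] :
    HasProd (fun i : ℕ ↦ 1 - ((X : ℤ⟦X⟧) ^ (i + 1)) ^ k) (euler k) := by
  convert hasProd_qProd (-1 : ℤ) k k using 2 with i
  · rw [map_neg, map_one, neg_one_mul, ← sub_eq_add_neg, ← pow_mul, mul_comm (i + 1), mul_add_one]
  · rfl

theorem hasProd_euler_mul (l t : ℕ) [NeZero l] [NeZero t] :
    HasProd (fun i : ℕ ↦ if l ∣ i + 1 then 1 - ((X : ℤ⟦X⟧) ^ (i + 1)) ^ t else 1)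
      (euler (l * t)) := by
  obtain ⟨l, rfl⟩ := Nat.exists_eq_add_one_of_ne_zero (NeZero.ne l)
  have hinj : Function.Injective fun i ↦ (l + 1) * i + l := fun i j hij ↦
    Nat.eq_of_mul_eq_mul_left l.succ_pos (Nat.add_right_cancel hij)
  have hrange (i : ℕ) (hi : i ∉ Set.range fun i ↦ (l + 1) * i + l) : ¬ l + 1 ∣ i + 1 := by
    rintro ⟨_ | j, hj⟩
    · lia
    · exact hi ⟨j, by simp only; lia⟩
  rw [← hinj.hasProd_iff fun i hi ↦ if_neg (hrange i hi)]
  convert hasProd_euler ((l + 1) * t) using 2 with i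
  rw [Function.comp_apply, add_assoc, ← mul_add_one, if_pos (dvd_mul_right _ _), ← pow_mul,
    ← pow_mul, mul_right_comm, mul_comm]

theorem rdSeries_mul (l t : ℕ) [NeZero l] [NeZero t] :
    rdSeries l t * euler 1 * euler (l * t) = euler l * euler t := by
  have hl := hasProd_euler_mul l 1
  rw [mul_one] at hl
  refine (((hasProd_rdSeries l t).mul (hasProd_euler 1)).mul (hasProd_euler_mul l t)).unique ?_
  convert hl.mul (hasProd_euler t) using 2 with i
  split_ifs
  · rw [one_mul]
  · rw [pow_one, mul_one, one_mul, geom_sum_mul_neg]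

end GeneratingFunction

section Twist

instance charZero_powerSeries {R : Type*} [CommSemiring R] [CharZero R] : CharZero R⟦X⟧ :=
  charZero_of_injective_ringHom (C_injective (R := R))

instance : CharZero (FractionRing ℤ⟦X⟧) := IsFractionRing.charZero ℤ⟦X⟧

theorem rescale_neg_one_injective {R : Type*} [CommRing R] :
    Function.Injective (rescale (-1) : R⟦X⟧ → R⟦X⟧) := by
  refine Function.LeftInverse.injective (g := rescale (-1)) fun f ↦ ?_
  rw [rescale_rescale, neg_one_mul, neg_neg, rescale_one, RingHom.id_apply]

/-- The substitution `X ↦ -X` on the fraction field of `ℤ⟦X⟧`. -/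
noncomputable def twist : FractionRing ℤ⟦X⟧ →+* FractionRing ℤ⟦X⟧ :=
  IsFractionRing.map (j := rescale (-1 : ℤ)) rescale_neg_one_injective

theorem twist_toFrac (f : ℤ⟦X⟧) : twist (toFrac f) = toFrac (rescale (-1) f) := by
  simp only [twist, toFrac, IsFractionRing.map, IsLocalization.map_eq]

theorem twist_toFrac_X : twist (toFrac X) = -toFrac X := by
  rw [twist_toFrac, rescale_X, map_neg, map_one, neg_one_mul, map_neg]

theorem twist_eta_of_odd {k : ℕ} (hk : Odd k) :
    twist (eta k) = eta (2 * k) ^ 3 / (eta k * eta (4 * k)) := by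
  have := NeZero.mk hk.pos.ne'
  rw [eq_div_iff (mul_ne_zero (eta_ne_zero _) (eta_ne_zero _))]
  simp only [eta, twist_toFrac, ← map_mul, ← map_pow, rescale_neg_one_euler_mul hk]

theorem twist_eta_two_mul (k : ℕ) [NeZero k] : twist (eta (2 * k)) = eta (2 * k) := by
  rw [eta, twist_toFrac, ← expand_euler, rescale_expand _ (by norm_num)]

end Twist

section OddSeries

/-- The generating function of `RD^{(4,9)} (2 n + 1)`. -/
noncomputable def oddSeries : ℤ⟦X⟧ := slice 2 1 (rdSeries 4 9)

theorem toFrac_rdSeries : toFrac (rdSeries 4 9) = eta 4 * eta 9 / (eta 1 * eta 36) := by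
  have h := congrArg toFrac (rdSeries_mul 4 9)
  simp only [map_mul, ← eta.eq_1] at h
  rw [eq_div_iff (mul_ne_zero (eta_ne_zero 1) (eta_ne_zero 36)), ← mul_assoc]
  exact h

theorem twist_toFrac_rdSeries :
    twist (toFrac (rdSeries 4 9)) =
      eta 1 * eta 4 ^ 2 * eta 18 ^ 3 / (eta 2 ^ 3 * eta 9 * eta 36 ^ 2) := by
  simp only [toFrac_rdSeries, map_div₀, map_mul, twist_eta_of_odd (by decide : Odd 1),
    twist_eta_of_odd (by decide : Odd 9), twist_eta_two_mul 2, twist_eta_two_mul 18, Nat.reduceMul]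
  field_simp [eta_ne_zero]

theorem theta_neg_one_mul_sub_mul :
    theta (-1 : ℤˣ) 2 2 * theta (-1) 9 9 - theta (-1) 1 1 * theta (-1) 18 18 =
      2 * X * (theta (-1) 15 3 * theta (-1) 18 18 - X * (theta (-1) 30 6 * theta (-1) 9 9)) := by
  have h := congrArg (expand 2 two_ne_zero) (theta_neg_one_one_one (R := ℤ))
  simp only [map_sub, map_mul, map_ofNat, expand_X, expand_theta (by norm_num : 0 < 1 + 1),
    expand_theta (by norm_num : 0 < 9 + 9), expand_theta (by norm_num : 0 < 15 + 3)] at h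
  rw [h, theta_neg_one_one_one]
  ring

theorem eta_dissection :
    eta 1 * eta 4 / eta 2 = eta 3 * eta 12 * eta 18 ^ 5 / (eta 6 ^ 2 * eta 9 ^ 2 * eta 36 ^ 2) -
      toFrac X * (eta 9 * eta 36 / eta 18) := by
  have h := congrArg (twist ∘ toFrac) (theta_one_three_one (R := ℤ))
  simp only [Function.comp_apply, map_add, map_mul, map_pow, map_div₀, toFrac_theta_one_three_mul 1,
    toFrac_theta_one_three_mul 9, toFrac_theta_one_two_mul 3, twist_eta_of_odd (by decide : Odd 1),
    twist_eta_of_odd (by decide : Odd 3), twist_eta_of_odd (by decide : Odd 9),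
    twist_eta_two_mul 1, twist_eta_two_mul 3, twist_eta_two_mul 9, twist_toFrac_X,
    Nat.reduceMul] at h
  field_simp [eta_ne_zero] at h ⊢
  linear_combination h

theorem toFrac_rdSeries_sub_twist :
    toFrac (rdSeries 4 9) - twist (toFrac (rdSeries 4 9)) =
      2 * toFrac X * toFrac (expand 2 two_ne_zero oddSeries) := by
  have hadd := congrArg toFrac (expand_slice_add (rdSeries 4 9))
  have hsub := congrArg toFrac (expand_slice_sub (rdSeries 4 9))
  rw [map_add, map_mul] at hadd
  rw [← twist_toFrac, map_sub, map_mul] at hsub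
  rw [oddSeries]
  linear_combination hsub - hadd

theorem toFrac_expand_oddSeries :
    toFrac (expand 2 two_ne_zero oddSeries) = eta 4 ^ 3 * eta 6 / (eta 2 ^ 3 * eta 12) := by
  have hX : toFrac X ≠ 0 := (map_ne_zero_iff _ toFrac_injective).mpr X_ne_zero
  have htheta := congrArg toFrac theta_neg_one_mul_sub_mul
  simp only [map_sub, map_mul, map_ofNat, toFrac_theta_neg_one_self,
    toFrac_theta_neg_one_five_mul 3, toFrac_theta_neg_one_five_mul 6, Nat.reduceMul] at htheta
  have hdiff := toFrac_rdSeries_sub_twist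
  rw [twist_toFrac_rdSeries, toFrac_rdSeries] at hdiff
  apply mul_left_cancel₀ (mul_ne_zero two_ne_zero hX)
  calc 2 * toFrac X * toFrac (expand 2 two_ne_zero oddSeries)
      = eta 4 ^ 2 * eta 18 / (eta 36 * eta 1 * eta 9 * eta 2 ^ 2) *
          (eta 2 ^ 2 / eta 4 * (eta 9 ^ 2 / eta 18) -
            eta 1 ^ 2 / eta 2 * (eta 18 ^ 2 / eta 36)) := by
        rw [← hdiff]
        field_simp [eta_ne_zero]
    _ = 2 * toFrac X * (eta 4 ^ 2 * eta 6 / (eta 1 * eta 2 ^ 2 * eta 12) *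
          (eta 3 * eta 12 * eta 18 ^ 5 / (eta 6 ^ 2 * eta 9 ^ 2 * eta 36 ^ 2) -
            toFrac X * (eta 9 * eta 36 / eta 18))) := by
        rw [htheta]
        field_simp [eta_ne_zero]
    _ = 2 * toFrac X * (eta 4 ^ 3 * eta 6 / (eta 2 ^ 3 * eta 12)) := by
        rw [← eta_dissection]
        field_simp [eta_ne_zero]

theorem oddSeries_mul : oddSeries * (euler 1 ^ 3 * euler 6) = euler 2 ^ 3 * euler 3 := by
  apply expand_injective two_ne_zero
  apply toFrac_injective
  simp only [map_mul, map_pow, expand_euler, toFrac_expand_oddSeries, ← eta.eq_1, Nat.reduceMul]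
  exact div_mul_cancel₀ _ (mul_ne_zero (pow_ne_zero 3 (eta_ne_zero 2)) (eta_ne_zero 12))

theorem toFrac_oddSeries : toFrac oddSeries = eta 2 ^ 3 * eta 3 / (eta 1 ^ 3 * eta 6) := by
  rw [eq_div_iff (mul_ne_zero (pow_ne_zero 3 (eta_ne_zero 1)) (eta_ne_zero 6))]
  simpa only [map_mul, map_pow, ← eta.eq_1] using congrArg toFrac oddSeries_mul

end OddSeries

section FunctionalEquations

theorem oddSeries_mul_rescale :
    oddSeries * rescale (-1) oddSeries = expand 2 two_ne_zero oddSeries := by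
  apply toFrac_injective
  rw [map_mul, ← twist_toFrac, toFrac_oddSeries, toFrac_expand_oddSeries]
  simp only [map_div₀, map_mul, map_pow, twist_eta_of_odd (by decide : Odd 1),
    twist_eta_of_odd (by decide : Odd 3), twist_eta_two_mul 1, twist_eta_two_mul 3, Nat.reduceMul]
  field_simp [eta_ne_zero]

theorem theta_mul_add_rescale :
    theta (-1 : ℤˣ) 5 1 ^ 3 * theta (-1) 3 3 +
        rescale (-1) (theta (-1 : ℤˣ) 5 1 ^ 3 * theta (-1) 3 3) =
      2 * (theta 1 4 2 ^ 3 * theta 1 18 6) := by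
  have hneg := theta_neg_one_pow_four
  have hpos := congrArg (rescale (-1 : ℤ)) theta_neg_one_pow_four
  have hdiff₁ := theta_one_pow_four_sub_theta_neg_one_pow_four
  have hdiff₃ := congrArg (expand 3 three_ne_zero) hdiff₁
  have hpsi := congrArg (expand 2 two_ne_zero) theta_one_three_one_pow_four
  simp only [map_sub, map_mul, map_pow, map_neg, map_one, map_ofNat, rescale_X, neg_mul, one_mul,
    rescale_neg_one_theta odd_one odd_one, mul_neg, neg_neg,
    rescale_neg_one_theta (by decide : Odd 3) (by decide : Odd 3)] at hpos
  simp only [map_sub, map_add, map_mul, map_pow, map_ofNat, expand_X,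
    expand_theta (by norm_num : 0 < 1 + 1), expand_theta (by norm_num : 0 < 6 + 2),
    expand_theta (by norm_num : 0 < 3 + 1), expand_theta (by norm_num : 0 < 2 + 1),
    expand_theta (by norm_num : 0 < 9 + 3), Nat.reduceMul] at hdiff₃ hpsi
  have h8X : (8 * X : ℤ⟦X⟧) ≠ 0 := mul_ne_zero (by norm_num) X_ne_zero
  apply mul_left_cancel₀ h8X
  rw [map_mul, map_pow, rescale_neg_one_theta (by decide : Odd 3) (by decide : Odd 3), neg_neg]
  linear_combination hdiff₁ - hdiff₃ + hneg - hpos + 16 * X * hpsi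

theorem theta_mul_oddSeries :
    theta (-1 : ℤˣ) 5 1 ^ 3 * theta (-1) 3 3 * oddSeries = euler 6 ^ 4 := by
  apply toFrac_injective
  simp only [map_mul, map_pow, toFrac_theta_neg_one_five_mul 1, toFrac_theta_neg_one_self,
    toFrac_oddSeries, ← eta.eq_1, Nat.reduceMul]
  field_simp [eta_ne_zero]

theorem euler_mul_expand_oddSeries :
    euler 6 ^ 4 * expand 2 two_ne_zero oddSeries =
      theta (1 : ℤˣ) 4 2 ^ 3 * theta 1 18 6 := by
  apply toFrac_injective
  simp only [map_mul, map_pow, toFrac_theta_one_two_mul 2, toFrac_theta_one_three_mul 6,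
    toFrac_expand_oddSeries, ← eta.eq_1, Nat.reduceMul]
  field_simp [eta_ne_zero]

theorem oddSeries_add_rescale :
    oddSeries + rescale (-1) oddSeries = 2 * expand 2 two_ne_zero oddSeries ^ 2 := by
  have hrescale := congrArg (rescale (-1)) theta_mul_oddSeries
  rw [map_mul, map_pow, ← expand_euler 2 3, rescale_expand _ (by norm_num),
    expand_euler] at hrescale
  apply mul_left_cancel₀ (pow_ne_zero 4 (euler_ne_zero 6))
  linear_combination oddSeries * rescale (-1) oddSeries * theta_mul_add_rescale -
    rescale (-1) oddSeries * theta_mul_oddSeries - oddSeries * hrescale -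
    2 * oddSeries * rescale (-1) oddSeries * euler_mul_expand_oddSeries +
    2 * euler 6 ^ 4 * expand 2 two_ne_zero oddSeries * oddSeries_mul_rescale

theorem slice_two_zero_oddSeries : slice 2 0 oddSeries = oddSeries ^ 2 := by
  apply expand_injective two_ne_zero
  apply mul_left_cancel₀ (two_ne_zero' ℤ⟦X⟧)
  rw [map_pow]
  linear_combination expand_slice_add oddSeries + expand_slice_sub oddSeries +
    oddSeries_add_rescale

theorem oddSeries_pow_four_sub :
    oddSeries ^ 4 - X * slice 2 1 oddSeries ^ 2 = oddSeries := by
  have hadd := expand_slice_add oddSeries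
  have hsub := expand_slice_sub oddSeries
  rw [slice_two_zero_oddSeries, map_pow] at hadd hsub
  apply expand_injective two_ne_zero
  rw [map_sub, map_mul, map_pow, map_pow, expand_X]
  linear_combination oddSeries_mul_rescale + rescale (-1) oddSeries * hadd +
    (expand 2 two_ne_zero oddSeries ^ 2 +
      X * expand 2 two_ne_zero (slice 2 1 oddSeries)) * hsub

end FunctionalEquations

section OddSlice

theorem toFrac_oddSeries_pow_four_sub :
    toFrac oddSeries ^ 4 - toFrac oddSeries =
      9 * toFrac X * eta 2 ^ 4 * eta 6 ^ 4 / eta 1 ^ 8 := by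
  have hphi := congrArg toFrac theta_neg_one_pow_four
  have hpsi := congrArg toFrac theta_one_three_one_pow_four
  simp only [map_mul, map_sub, map_add, map_pow, map_ofNat, toFrac_theta_neg_one_self,
    toFrac_theta_neg_one_five_mul 1, toFrac_theta_one_two_mul 1, toFrac_theta_one_three_mul 1,
    toFrac_theta_one_three_mul 3, Nat.reduceMul] at hphi hpsi
  rw [toFrac_oddSeries]
  linear_combination (norm := skip)
    eta 2 ^ 4 * eta 3 ^ 4 / (eta 1 ^ 8 * eta 6 ^ 4) * hpsi -
      eta 2 ^ 7 * eta 3 / (eta 1 ^ 11 * eta 6) * hphi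
  field_simp [eta_ne_zero]
  ring

theorem slice_oddSeries_mul_sq :
    (slice 2 1 oddSeries * euler 1 ^ 4) ^ 2 = (3 * euler 2 ^ 2 * euler 6 ^ 2) ^ 2 := by
  have h : (oddSeries ^ 4 - oddSeries) * euler 1 ^ 8 = 9 * X * euler 2 ^ 4 * euler 6 ^ 4 := by
    apply toFrac_injective
    simp only [map_mul, map_sub, map_pow, map_ofNat, ← eta.eq_1, toFrac_oddSeries_pow_four_sub]
    exact div_mul_cancel₀ _ (pow_ne_zero 8 (eta_ne_zero 1))
  apply mul_left_cancel₀ X_ne_zero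
  linear_combination h - euler 1 ^ 8 * oddSeries_pow_four_sub

theorem slice_oddSeries_mul :
    slice 2 1 oddSeries * euler 1 ^ 4 = 3 * euler 2 ^ 2 * euler 6 ^ 2 := by
  refine (sq_eq_sq_iff_eq_or_eq_neg.mp slice_oddSeries_mul_sq).resolve_right fun hneg ↦ ?_
  have hcoeff := congrArg constantCoeff hneg
  simp only [map_mul, map_neg, map_pow, map_ofNat, constantCoeff_euler] at hcoeff
  have hnonneg : 0 ≤ constantCoeff (slice 2 1 oddSeries) := by
    rw [← coeff_zero_eq_constantCoeff_apply, coeff_slice, oddSeries, coeff_slice, rdSeries,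
      coeff_mk]
    exact Int.natCast_nonneg _
  lia

end OddSlice

section Congruences

theorem isUnit_euler (k : ℕ) [NeZero k] : IsUnit (euler k) :=
  isUnit_iff_constantCoeff.mpr (by rw [constantCoeff_euler]; exact isUnit_one)

theorem dvd_euler_pow_sub {p : ℕ} (hp : p.Prime) (k : ℕ) [NeZero k] :
    (p : ℤ⟦X⟧) ∣ euler k ^ p - euler (p * k) := by
  have := NeZero.mk hp.ne_zero
  rw [← expand_euler]
  exact dvd_pow_sub_expand hp _

theorem three_dvd_oddSeries_sub_one : 3 ∣ oddSeries - 1 := by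
  rw [← ((isUnit_euler 1).pow 3 |>.mul (isUnit_euler 6)).dvd_mul_right]
  have h₁ : 3 ∣ euler 1 ^ 3 - euler 3 := dvd_euler_pow_sub Nat.prime_three 1
  have h₂ : 3 ∣ euler 2 ^ 3 - euler 6 := dvd_euler_pow_sub Nat.prime_three 2
  rw [show (oddSeries - 1) * (euler 1 ^ 3 * euler 6) =
      (euler 2 ^ 3 - euler 6) * euler 3 - (euler 1 ^ 3 - euler 3) * euler 6 by
    linear_combination oddSeries_mul]
  exact dvd_sub (h₂.mul_right _) (h₁.mul_right _)

theorem slice_three_two_theta : slice 3 2 (theta (1 : ℤˣ) 3 1) = 0 := by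
  have h₀ := expand_theta (by norm_num : 0 < 2 + 1) 3 (1 : ℤˣ)
  have h₁ := expand_theta (by norm_num : 0 < 9 + 3) 3 (1 : ℤˣ)
  simp only [Nat.reduceMul] at h₀ h₁
  rw [theta_one_three_one, map_add, slice_succ_X_mul 3 1, ← h₀, ← h₁,
    slice_expand_of_not_dvd _ (by lia), slice_expand_of_not_dvd _ (by lia), add_zero]

theorem two_dvd_slice_three_two_oddSeries : 2 ∣ slice 3 2 oddSeries := by
  have hpsi : theta (1 : ℤˣ) 3 1 * euler 1 = euler 2 ^ 2 := theta_one_three_mul_mul_euler 1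
  have heuler : 2 ∣ euler 1 ^ 2 - euler 2 := dvd_euler_pow_sub Nat.prime_two 1
  have hsub : 2 ∣ oddSeries * euler (3 * 2) - theta (1 : ℤˣ) 3 1 * euler (3 * 1) := by
    rw [← ((isUnit_euler 1).pow 3).dvd_mul_right]
    rw [show (oddSeries * euler (3 * 2) - theta (1 : ℤˣ) 3 1 * euler (3 * 1)) * euler 1 ^ 3 =
        (euler 1 ^ 2 - euler 2) * -(euler 2 ^ 2 * euler 3) by
      linear_combination oddSeries_mul - euler 1 ^ 2 * euler 3 * hpsi]
    exact heuler.mul_right _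
  have h := (dvd_slice_iff_of_dvd_sub 3 2 hsub).mpr
  rw [← expand_euler, ← expand_euler, slice_mul_expand (by norm_num),
    slice_mul_expand (by norm_num), slice_three_two_theta, zero_mul,
    (isUnit_euler 2).dvd_mul_right] at h
  exact h (dvd_zero 2)

theorem oddSeries_sq_eq :
    oddSeries ^ 2 = expand 2 two_ne_zero (2 * oddSeries ^ 4 - oddSeries) +
      X * expand 2 two_ne_zero (2 * (oddSeries ^ 2 * slice 2 1 oddSeries)) := by
  have hadd := expand_slice_add oddSeries
  have hpow := congrArg (expand 2 two_ne_zero) oddSeries_pow_four_sub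
  rw [slice_two_zero_oddSeries, map_pow] at hadd
  simp only [map_sub, map_mul, map_pow, map_ofNat, expand_X] at hpow ⊢
  linear_combination -hpow - (oddSeries + expand 2 two_ne_zero oddSeries ^ 2 +
    X * expand 2 two_ne_zero (slice 2 1 oddSeries)) * hadd

theorem slice_two_zero_oddSeries_sq :
    slice 2 0 (oddSeries ^ 2) = 2 * oddSeries ^ 4 - oddSeries :=
  (congrArg _ oddSeries_sq_eq).trans (slice_two_zero_expand_add _ _)

theorem slice_two_one_oddSeries_sq :
    slice 2 1 (oddSeries ^ 2) = 2 * (oddSeries ^ 2 * slice 2 1 oddSeries) :=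
  (congrArg _ oddSeries_sq_eq).trans (slice_two_one_expand_add _ _)

theorem four_dvd_slice_oddSeries_sub : 4 ∣ slice 2 1 oddSeries - 3 * euler 6 ^ 2 := by
  rw [← ((isUnit_euler 1).pow 4).dvd_mul_right]
  obtain ⟨h, hh⟩ : 2 ∣ euler 1 ^ 2 - euler 2 := dvd_euler_pow_sub Nat.prime_two 1
  refine ⟨-3 * euler 6 ^ 2 * h * (euler 2 + h), ?_⟩
  linear_combination slice_oddSeries_mul - 3 * euler 6 ^ 2 * (euler 1 ^ 2 + euler 2 + 2 * h) * hh

theorem two_dvd_theta_neg_one_sub_one (k : ℕ) [NeZero k] : 2 ∣ theta (-1 : ℤˣ) k k - 1 := by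
  rw [← (isUnit_euler (2 * k)).dvd_mul_right, sub_one_mul, theta_neg_one_mul_euler]
  exact dvd_euler_pow_sub Nat.prime_two k

theorem eight_dvd_slice_oddSeries_sub :
    8 ∣ slice 2 1 oddSeries - theta (1 : ℤˣ) 1 1 ^ 2 * (3 * euler 6 ^ 2) := by
  have hunit : IsUnit (theta (-1 : ℤˣ) 1 1) :=
    isUnit_of_mul_isUnit_left (theta_neg_one_mul_euler 1 ▸ (isUnit_euler 1).pow 2)
  have hmul : slice 2 1 oddSeries * theta (-1 : ℤˣ) 1 1 ^ 2 = 3 * euler 6 ^ 2 := by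
    apply mul_right_cancel₀ (pow_ne_zero 2 (euler_ne_zero 2))
    linear_combination slice_oddSeries_mul + slice 2 1 oddSeries *
      (theta (-1 : ℤˣ) 1 1 * euler 2 + euler 1 ^ 2) * theta_neg_one_mul_euler 1
  have htheta : theta 1 1 1 * theta (-1) 1 1 = theta (-1 : ℤˣ) 2 2 ^ 2 :=
    theta_one_mul_theta_neg_one 1
  obtain ⟨h, hh⟩ := two_dvd_theta_neg_one_sub_one 2
  rw [← (hunit.pow 2).dvd_mul_right]
  refine ⟨-3 * euler 6 ^ 2 * (h + 3 * h ^ 2 + 4 * h ^ 3 + 2 * h ^ 4), ?_⟩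
  rw [sub_mul, hmul, mul_right_comm, ← mul_pow, htheta, eq_add_of_sub_eq hh]
  ring

theorem three_mul_euler_sq (m k : ℕ) [NeZero m] [NeZero k] :
    3 * euler (m * k) ^ 2 = expand m (NeZero.ne m) (3 * euler k ^ 2) := by
  rw [map_mul, map_pow, map_ofNat, expand_euler]

theorem eight_dvd_slice_twelve_eleven : 8 ∣ slice 12 11 oddSeries := by
  have hpsi : 2 ∣ slice 6 4 (theta (1 : ℤˣ) 12 4 ^ 2) := by
    refine (dvd_slice_iff_of_dvd_sub 6 4 (dvd_pow_sub_expand Nat.prime_two _)).mpr ?_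
    rw [expand_theta (by norm_num), ← expand_theta (m := 8) (a := 3) (b := 1) (by norm_num)]
    refine dvd_slice_expand (m := 3) (r := 2) (by norm_num) (fun i hi ↦ ?_) (by norm_num) ?_
    · rw [Nat.ModEq] at hi ⊢
      lia
    · rw [slice_three_two_theta]
      exact dvd_zero 2
  have hphi : 8 ∣ slice 6 5 (theta (1 : ℤˣ) 1 1 ^ 2) := by
    rw [theta_one_sq, ← expand_theta (m := 2) (a := 1) (b := 1) (by norm_num), ← map_pow, map_add,
      slice_expand_of_not_dvd _ (by lia), zero_add, mul_assoc, slice_ofNat_mul,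
      slice_succ_X_mul 6 4]
    exact (by norm_num : (8 : ℤ⟦X⟧) = 4 * 2) ▸ mul_dvd_mul_left 4 hpsi
  have hodd : 8 ∣ slice 6 5 (slice 2 1 oddSeries) := by
    refine (dvd_slice_iff_of_dvd_sub 6 5 eight_dvd_slice_oddSeries_sub).mpr ?_
    rw [three_mul_euler_sq 6 1, slice_mul_expand (by norm_num)]
    exact hphi.mul_right _
  rwa [slice_slice] at hodd

theorem dvd_slice_sq_mul {d m r : ℕ} [d.AtLeastTwo] (hr : r < m) {k : ℕ} [NeZero k] [NeZero m]
    (hmk : m * k = 6) (hd : (ofNat(d) : ℤ⟦X⟧) ∣ 4)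
    (h : (ofNat(d) : ℤ⟦X⟧) ∣ slice m r (oddSeries ^ 2)) :
    (ofNat(d) : ℤ⟦X⟧) ∣ slice m r (oddSeries ^ 2 * slice 2 1 oddSeries) := by
  have hsub := hd.trans (four_dvd_slice_oddSeries_sub.mul_left (oddSeries ^ 2))
  rw [mul_sub] at hsub
  rw [dvd_slice_iff_of_dvd_sub m r hsub, ← hmk, three_mul_euler_sq, slice_mul_expand hr]
  exact h.mul_right _

theorem eight_dvd_slice_twenty_four_fourteen : 8 ∣ slice 24 14 oddSeries := by
  have hsq : 2 ∣ slice 3 1 (oddSeries ^ 2) := by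
    refine (dvd_slice_iff_of_dvd_sub 3 1 (dvd_pow_sub_expand Nat.prime_two _)).mpr ?_
    refine dvd_slice_expand two_ne_zero (fun i hi ↦ ?_) (by norm_num)
      two_dvd_slice_three_two_oddSeries
    rw [Nat.ModEq] at hi ⊢
    lia
  have hsq' : 4 ∣ slice 6 3 (oddSeries ^ 2) := by
    rw [← slice_slice 3 1 2 1, slice_two_one_oddSeries_sq, slice_ofNat_mul]
    exact (by norm_num : (4 : ℤ⟦X⟧) = 2 * 2) ▸
      mul_dvd_mul_left 2 (dvd_slice_sq_mul (k := 2) (by norm_num) rfl ⟨2, by norm_num⟩ hsq)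
  have hslice : slice 24 14 oddSeries = 2 * slice 6 3 (oddSeries ^ 2 * slice 2 1 oddSeries) := by
    rw [← slice_slice 12 7 2 0, slice_two_zero_oddSeries, ← slice_slice 6 3 2 1,
      slice_two_one_oddSeries_sq, slice_ofNat_mul]
  rw [hslice]
  exact (by norm_num : (8 : ℤ⟦X⟧) = 2 * 4) ▸
    mul_dvd_mul_left 2 (dvd_slice_sq_mul (k := 1) (by norm_num) rfl dvd_rfl hsq')

theorem eight_dvd_slice_forty_eight_forty_four : 8 ∣ slice 48 44 oddSeries := by
  have hpow : 4 ∣ slice 2 1 (oddSeries ^ 4) := by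
    obtain ⟨h, hh⟩ : 2 ∣ oddSeries ^ 2 - expand 2 two_ne_zero oddSeries :=
      dvd_pow_sub_expand Nat.prime_two _
    have hsub : 4 ∣ oddSeries ^ 4 - expand 2 two_ne_zero (oddSeries ^ 2) := by
      refine ⟨h * (expand 2 two_ne_zero oddSeries + h), ?_⟩
      rw [map_pow]
      linear_combination (oddSeries ^ 2 + expand 2 two_ne_zero oddSeries + 2 * h) * hh
    rw [dvd_slice_iff_of_dvd_sub 2 1 hsub, slice_expand_of_not_dvd _ (by lia)]
    exact dvd_zero 4
  have hslice : slice 48 44 oddSeries =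
      2 * slice 6 5 (slice 2 1 (oddSeries ^ 4)) - slice 12 11 oddSeries := by
    rw [slice_slice, ← slice_ofNat_mul, ← map_sub, ← slice_two_zero_oddSeries_sq,
      ← slice_two_zero_oddSeries, slice_slice, slice_slice]
  rw [hslice]
  exact dvd_sub ((by norm_num : (8 : ℤ⟦X⟧) = 2 * 4) ▸ mul_dvd_mul_left 2 (dvd_slice 6 5 hpow))
    eight_dvd_slice_twelve_eleven

theorem three_dvd_RD {n : ℕ} (hn : n ≠ 0) : 3 ∣ RD 4 9 (2 * n + 1) := by
  have h := ofNat_dvd_iff_forall_coeff.mp three_dvd_oddSeries_sub_one n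
  rw [map_sub, coeff_one, if_neg hn, sub_zero, oddSeries, coeff_slice, rdSeries, coeff_mk] at h
  exact_mod_cast h

theorem RD_modEq_zero {m r : ℕ} (hr : r ≠ 0) (h : 8 ∣ slice m r oddSeries) (n : ℕ) :
    RD 4 9 (2 * (m * n + r) + 1) ≡ 0 [MOD 24] := by
  have h₈ := ofNat_dvd_iff_forall_coeff.mp h n
  rw [coeff_slice, oddSeries, coeff_slice, rdSeries, coeff_mk] at h₈
  have h₃ : 3 ∣ RD 4 9 (2 * (m * n + r) + 1) := three_dvd_RD (by lia)
  exact Nat.modEq_zero_iff_dvd.mpr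
    (Nat.Coprime.mul_dvd_of_dvd_of_dvd (m := 3) (n := 8) (by norm_num) h₃ (by exact_mod_cast h₈))

end Congruences

theorem theorem6p1 :
    (∀ n : ℕ, RD 4 9 (24 * n + 23) ≡ 0 [MOD 24]) ∧
    (∀ n : ℕ, RD 4 9 (48 * n + 29) ≡ 0 [MOD 24]) ∧
    (∀ n : ℕ, RD 4 9 (96 * n + 89) ≡ 0 [MOD 24]) := by
  refine ⟨fun n ↦ ?_, fun n ↦ ?_, fun n ↦ ?_⟩
  · convert RD_modEq_zero (by norm_num) eight_dvd_slice_twelve_eleven n using 2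
    ring
  · convert RD_modEq_zero (by norm_num) eight_dvd_slice_twenty_four_fourteen n using 2
    ring
  · convert RD_modEq_zero (by norm_num) eight_dvd_slice_forty_eight_forty_four n using 2
    ring
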